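/- Let $\mathbb D$ be the open unit disc and $\mathbb T=\partial\mathbb D$. Let $b$ be a rational function in the closed unit ball of $H^\infty$, with $\|b\|_\infty=1$, which is not inner (that is, not a finite Blaschke product), and let $\mathcal H(b)$ be its de Branges–Rovnyak space. Let $\tilde a$ be the Pythagorean mate of $b$, i.e. the outer function with $|\tilde a|^2+|b|^2=1$ on $\mathbb T$ and $\tilde a(0)>0$ (it is a rational function without poles in $\overline{\mathbb D}$), and let $\zeta_1,\dots,\zeta_n$ be the distinct zeros of $\tilde a$ on $\mathbb T$, with multiplicities $m_1,\dots,m_n$. Let $u:\mathbb D\to\mathbb C$ and $\varphi:\mathbb D\to\mathbb D$ be analytic and suppose that the weighted composition operator $W_{u,\varphi}:f\mapsto u\cdot(f\circ\varphi)$ is bounded from $\mathcal H(b)$ into itself. For a function $f$ on $\mathbb D$ we write $f(\zeta_k)$ for its non-tangential limit at $\zeta_k$. Let $1\le k,\ell\le n$, and suppose that $\varphi$ has a non-tangential limit at $\zeta_k$ with $\varphi(\zeta_k)=\zeta_\ell$. Then $$\liminf_{z\to\zeta_k,\ z\in\mathbb D}\ |u(z)|^2\,\frac{(1-|\varphi(z)|)^{2m_\ell-1}}{(1-|z|)^{2m_k-1}}<\infty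 .$$ Moreover, the non-tangential limit $u(\zeta_k)$ exists, and if $u(\zeta_k)\neq 0$, then $m_k\le m_\ell$. If $u(\zeta_k)\ne0$ and $m_k=m_\ell$, then $\varphi$ has an angular derivative in the sense of Carathéodory at $\zeta_k$; that is, $\varphi$ and $\varphi'$ both have a non-tangential limit at $\zeta_k$, and $|\varphi(\zeta_k)|=1$. -/

import Mathlib

/-- Quadratic `L²`-mean data of a function on the unit disc:
`sup_{0 ≤ r < 1} (1/2π) ∫ |f(r e^{it})|² dt`, the square of the norm of the Hardy space `H²`
(a meaningful number only for members of `H²`). -/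
noncomputable def hardyNormSq (f : ℂ → ℂ) : ℝ :=
  ⨆ r : Set.Ico (0 : ℝ) 1, Real.circleAverage (fun z => ‖f z‖ ^ 2) 0 (r : ℝ)

/-- `f` belongs to the Hardy space `H²` of the open unit disc. Only the values of `f` on the open
unit disc matter. -/
def MemHardy (f : ℂ → ℂ) : Prop :=
  DifferentiableOn ℂ f (Metric.ball 0 1) ∧
    BddAbove (Set.range fun r : Set.Ico (0 : ℝ) 1 =>
      Real.circleAverage (fun z => ‖f z‖ ^ 2) 0 (r : ℝ))

/-- The set of all numbers `‖f + b g‖₂² - ‖g‖₂²`, `g ∈ H²`. -/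
def deBrangesDefects (b f : ℂ → ℂ) : Set ℝ :=
  {t | ∃ g : ℂ → ℂ, MemHardy g ∧ t = hardyNormSq (fun z => f z + b z * g z) - hardyNormSq g}

/-- `f` belongs to the de Branges–Rovnyak space `H(b)`, for `b` in the closed unit ball of `H^∞`.
This is the original definition of de Branges and Rovnyak: `H(b)` is the space complementary to
`b H²` in `H²`, that is, the set of all `f ∈ H²` with
`sup_{g ∈ H²} (‖f + b g‖₂² - ‖g‖₂²) < ∞`. -/
def MemDeBranges (b f : ℂ → ℂ) : Prop :=
  MemHardy f ∧ BddAbove (deBrangesDefects b f)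

/-- The norm of `H(b)`: `‖f‖_b² = sup_{g ∈ H²} (‖f + b g‖₂² - ‖g‖₂²)`. -/
noncomputable def deBrangesNorm (b f : ℂ → ℂ) : ℝ :=
  Real.sqrt (sSup (deBrangesDefects b f))

/-- The weighted composition operator `W_{u,φ} : f ↦ u · (f ∘ φ)` maps `H(b)` into itself and is
bounded there. -/
def IsBoundedWeightedComposition (b u φ : ℂ → ℂ) : Prop :=
  ∃ C : ℝ, ∀ f : ℂ → ℂ, MemDeBranges b f →
    MemDeBranges b (fun z => u z * f (φ z)) ∧
      deBrangesNorm b (fun z => u z * f (φ z)) ≤ C * deBrangesNorm b f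

/-- The function on `ℂ` given by a rational function (with the value `0` at its poles). -/
noncomputable def ratFun (q : RatFunc ℂ) (z : ℂ) : ℂ :=
  RatFunc.eval (RingHom.id ℂ) z q

/-- `F`, given on the closed unit disc, is outer: it has no zero in the open disc and there
`log |F|` is the Poisson integral of its boundary values on the unit circle. -/
def IsOuterOnDisc (F : ℂ → ℂ) : Prop :=
  ∀ z ∈ Metric.ball (0 : ℂ) 1, F z ≠ 0 ∧
    Real.log ‖F z‖ = Real.circleAverage (fun w => poissonKernel 0 z w * Real.log ‖F w‖) 0 1

/-- `a` is the Pythagorean mate of the rational function `b`: the outer function with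
`|a|² + |b|² = 1` on the unit circle and `a(0) > 0`. It is unique, and for rational `b` in the
closed unit ball of `H^∞`, not inner, it is a rational function without poles in the closed disc. -/
structure IsPythagoreanMate (b a : RatFunc ℂ) : Prop where
  denom_ne_zero : ∀ z ∈ Metric.closedBall (0 : ℂ) 1, a.denom.eval z ≠ 0
  outer : IsOuterOnDisc (ratFun a)
  normSq_add_normSq : ∀ z ∈ Metric.sphere (0 : ℂ) 1, ‖ratFun a z‖ ^ 2 + ‖ratFun b z‖ ^ 2 = 1
  pos_at_zero : ∃ x : ℝ, 0 < x ∧ ratFun a 0 = (x : ℂ)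

/-- `f`, given on the open unit disc, has the non-tangential limit `L` at the point `ζ` of the
unit circle: `f(z) → L` as `z → ζ` within every Stolz region `|z - ζ| < M (1 - |z|)`. -/
def HasNontangentialLimit (f : ℂ → ℂ) (ζ L : ℂ) : Prop :=
  ∀ M : ℝ, Filter.Tendsto f
    (nhdsWithin ζ {z : ℂ | ‖z‖ < 1 ∧ ‖z - ζ‖ < M * (1 - ‖z‖)}) (nhds L)

/-- `φ` has an angular derivative in the sense of Carathéodory at `ζ`: `φ` and `φ'` have
non-tangential limits at `ζ`, and that of `φ` has modulus one. -/
def HasAngularDerivative (φ : ℂ → ℂ) (ζ : ℂ) : Prop :=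
  (∃ L : ℂ, HasNontangentialLimit φ ζ L ∧ ‖L‖ = 1) ∧
    ∃ D : ℂ, HasNontangentialLimit (deriv φ) ζ D

/-! Write `b = B / D` and `a = A / D` over a common denominator, so that `|A|² + |B|² = |D|²` on the
circle. Testing the defining supremum of `H(b)` with `g = D G`, `G` a polynomial, gives `|⟨f, B G⟩|
≤ ‖f‖_b ‖A G‖₂` (`norm_sum_conj_mul_taylorCoeff_le`). By Hahn–Banach some `h ∈ H²` with `‖h‖₂ ≤
‖f‖_b` satisfies `⟨f, B G⟩ = ⟨h, A G⟩` for all `G`. In terms of the reflected polynomials `A*`, `B*`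
this means that `B* f = A* h + P` with `P` a polynomial of bounded degree
(`exists_polynomial_norm_sub_le`). At `ζ_k` the factor `A*` vanishes to order at least `m_k` while
`B*` does not vanish, so along the radius every `f ∈ H(b)` is a polynomial over `B*` up to `O((1 -
r)^(m_k - 1/2))`.

Conversely `a H²` lies contractively in `H(b)`. Apply the operator to `a k_w`, `k_w` the Szegő
kernel, whose norm is at most `(1 - |w|²)^(-1/2)`. If the polynomial part of the image vanishes to
order `m_k` at `ζ_k`, then its value at `rζ_k` is `O((1 - |w|²)^(-1/2) (1 - r)^(m_k - 1/2))`. With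
`w = φ(rζ_k)` and `|a(w)| ≥ κ (1 - |w|)^(m_ℓ)` this becomes `|u|² (1 - |φ|)^(2m_ℓ - 1) ≤ C (1 -
r)^(2m_k - 1)` along the radius (`exists_eventually_norm_sq_mul_le`), which bounds the lower limit.

The vanishing comes from an oscillation argument. With `q(w) = (1 - conj(ζ_ℓ) w)^i`, bounded on the
disc, both `u (a ∘ φ)` and `u (a q) ∘ φ` belong to `H(b)`. If the polynomial part of the first
vanished to lower order, the quotient would force `q(φ(rζ_k))` to converge, but it spins forever as
`φ(rζ_k) → ζ_ℓ`.

Since `1 ∈ H(b)`, also `u ∈ H(b)`, and the expansion provides `u(ζ_k)`. When this is nonzero, `(1 -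
|φ|)^(2m_ℓ - 1) = O((1 - r)^(2m_k - 1))`. Schwarz–Pick gives `1 - |φ(z)| ≥ c (1 - |z|)`, hence `m_k
≤ m_ℓ`; in case of equality `1 - |φ| = O(1 - r)`, and the Julia–Carathéodory theorem
(`hasAngularDerivative_of_one_sub_norm_le`) applies. -/

/-! ### Schwarz–Pick inequalities -/

theorem norm_one_sub_conj_mul_sq (z w : ℂ) :
    ‖1 - (starRingEnd ℂ) w * z‖ ^ 2 =
      ‖z - w‖ ^ 2 + (1 - ‖z‖ ^ 2) * (1 - ‖w‖ ^ 2) := by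
  simp only [← Complex.normSq_eq_norm_sq, Complex.normSq_apply, Complex.sub_re, Complex.sub_im,
    Complex.mul_re, Complex.mul_im, Complex.conj_re, Complex.conj_im, Complex.one_re,
    Complex.one_im]
  ring

theorem one_sub_conj_mul_ne_zero {z w : ℂ} (hz : ‖z‖ < 1) (hw : ‖w‖ < 1) :
    1 - (starRingEnd ℂ) w * z ≠ 0 := by
  intro h
  have h1 := norm_one_sub_conj_mul_sq z w
  rw [h, norm_zero] at h1
  have h2 : 0 < (1 - ‖z‖ ^ 2) * (1 - ‖w‖ ^ 2) :=
    mul_pos (by nlinarith [norm_nonneg z]) (by nlinarith [norm_nonneg w])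
  nlinarith [sq_nonneg ‖z - w‖]

theorem norm_moebius_lt_one {z w : ℂ} (hz : ‖z‖ < 1) (hw : ‖w‖ < 1) :
    ‖(z - w) / (1 - (starRingEnd ℂ) w * z)‖ < 1 := by
  have h0 := norm_pos_iff.2 (one_sub_conj_mul_ne_zero hz hw)
  rw [norm_div, div_lt_one h0]
  refine lt_of_pow_lt_pow_left₀ 2 h0.le ?_
  rw [norm_one_sub_conj_mul_sq]
  have h2 : 0 < (1 - ‖z‖ ^ 2) * (1 - ‖w‖ ^ 2) :=
    mul_pos (by nlinarith [norm_nonneg z]) (by nlinarith [norm_nonneg w])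
  linarith

/-- The Schwarz–Pick inequality for self-maps of the unit disc. -/
theorem schwarz_pick {φ : ℂ → ℂ} (hφ : DifferentiableOn ℂ φ (Metric.ball 0 1))
    (hmaps : Set.MapsTo φ (Metric.ball 0 1) (Metric.ball 0 1)) {z w : ℂ}
    (hz : ‖z‖ < 1) (hw : ‖w‖ < 1) :
    ‖φ z - φ w‖ ^ 2 * ((1 - ‖z‖ ^ 2) * (1 - ‖w‖ ^ 2)) ≤
      ‖z - w‖ ^ 2 * ((1 - ‖φ z‖ ^ 2) * (1 - ‖φ w‖ ^ 2)) := by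
  have hmaps' : ∀ {x : ℂ}, ‖x‖ < 1 → ‖φ x‖ < 1 := fun {x} hx => by
    simpa using hmaps (show x ∈ Metric.ball (0 : ℂ) 1 by simpa using hx)
  -- `T` is the disc automorphism with `T 0 = w`. Following `φ ∘ T` by the automorphism sending `φ
  -- w` to `0` gives a map fixing `0`, to which the Schwarz lemma applies at `ξ = T⁻¹ z`.
  set T : ℂ → ℂ := fun ξ => (ξ - -w) / (1 - (starRingEnd ℂ) (-w) * ξ) with hT
  have hw' : ‖-w‖ < 1 := by simpa using hw
  have hTlt : ∀ {x : ℂ}, ‖x‖ < 1 → ‖T x‖ < 1 := fun hx => norm_moebius_lt_one hx hw'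
  have hTd : DifferentiableOn ℂ T (Metric.ball 0 1) := by
    intro x hx
    refine DifferentiableAt.differentiableWithinAt ?_
    have := one_sub_conj_mul_ne_zero (by simpa using hx : ‖x‖ < 1) hw'
    fun_prop (disch := assumption)
  have hTm : Set.MapsTo T (Metric.ball 0 1) (Metric.ball 0 1) := fun x hx => by
    simpa using hTlt (by simpa using hx : ‖x‖ < 1)
  have hφT := hφ.comp hTd hTm
  set g : ℂ → ℂ := fun ξ => (φ (T ξ) - φ w) / (1 - (starRingEnd ℂ) (φ w) * φ (T ξ)) with hg
  have hgd : DifferentiableOn ℂ g (Metric.ball 0 1) := by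
    refine (hφT.sub_const _).div ((differentiableOn_const _).sub (hφT.const_mul _)) ?_
    intro x hx
    exact one_sub_conj_mul_ne_zero (hmaps' (hTlt (by simpa using hx))) (hmaps' hw)
  have hgm : Set.MapsTo g (Metric.ball 0 1) (Metric.closedBall 0 1) := fun x hx => by
    have := norm_moebius_lt_one (hmaps' (hTlt (by simpa using hx : ‖x‖ < 1))) (hmaps' hw)
    simpa only [Metric.mem_closedBall, dist_zero_right] using this.le
  have hg0 : g 0 = 0 := by simp [hg, hT]
  set ξ := (z - w) / (1 - (starRingEnd ℂ) w * z) with hξ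
  have hne := one_sub_conj_mul_ne_zero hz hw
  have hξ1 : ‖ξ‖ < 1 := norm_moebius_lt_one hz hw
  have hTξ : T ξ = z := by
    have h1 := one_sub_conj_mul_ne_zero hξ1 hw'
    have h2 : ξ * (1 - (starRingEnd ℂ) w * z) = z - w := div_mul_cancel₀ _ hne
    simp only [hT]
    rw [div_eq_iff h1, map_neg]
    linear_combination h2
  have key := Complex.norm_le_norm_of_mapsTo_ball hgd hgm hg0 hξ1
  simp only [hg, hTξ] at key
  rw [hξ, norm_div, norm_div] at key
  have hne' := one_sub_conj_mul_ne_zero (hmaps' hz) (hmaps' hw)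
  rw [div_le_div_iff₀ (norm_pos_iff.2 hne') (norm_pos_iff.2 hne)] at key
  have key2 := pow_le_pow_left₀ (by positivity) key 2
  rw [mul_pow, mul_pow, norm_one_sub_conj_mul_sq, norm_one_sub_conj_mul_sq] at key2
  nlinarith

/-- The Schwarz–Pick inequality for functions of positive real part on the unit disc. -/
theorem schwarz_pick_re {G : ℂ → ℂ} (hG : DifferentiableOn ℂ G (Metric.ball 0 1))
    (hpos : ∀ z : ℂ, ‖z‖ < 1 → 0 < (G z).re) {z w : ℂ} (hz : ‖z‖ < 1) (hw : ‖w‖ < 1) :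
    ‖G z - G w‖ ^ 2 * ((1 - ‖z‖ ^ 2) * (1 - ‖w‖ ^ 2)) ≤
      4 * ‖z - w‖ ^ 2 * ((G z).re * (G w).re) := by
  have hne : ∀ x : ℂ, ‖x‖ < 1 → G x + 1 ≠ 0 := fun x hx h => by
    have := congrArg Complex.re h
    simp only [Complex.add_re, Complex.one_re, Complex.zero_re] at this
    linarith [hpos x hx]
  -- The Cayley transform carries the right half-plane to the disc, reducing to `schwarz_pick`.
  set g : ℂ → ℂ := fun x => (G x - 1) / (G x + 1) with hg
  have hsq : ∀ x : ℂ, ‖x‖ < 1 → 1 - ‖g x‖ ^ 2 = 4 * (G x).re / ‖G x + 1‖ ^ 2 := fun x hx => by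
    have h1 := norm_pos_iff.2 (hne x hx)
    simp only [hg, norm_div, div_pow]
    rw [eq_div_iff (by positivity), sub_mul, div_mul_cancel₀ _ (by positivity), one_mul]
    simp only [← Complex.normSq_eq_norm_sq, Complex.normSq_apply, Complex.sub_re, Complex.sub_im,
      Complex.add_re, Complex.add_im, Complex.one_re, Complex.one_im]
    ring
  have hgd : DifferentiableOn ℂ g (Metric.ball 0 1) :=
    (hG.sub_const _).div (hG.add_const _) fun x hx => hne x (by simpa using hx)
  have hgm : Set.MapsTo g (Metric.ball 0 1) (Metric.ball 0 1) := fun x hx => by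
    have hx : ‖x‖ < 1 := by simpa using hx
    have h1 := norm_pos_iff.2 (hne x hx)
    have h2 : 0 < 1 - ‖g x‖ ^ 2 := by
      rw [hsq x hx]
      have := hpos x hx
      positivity
    simp only [Metric.mem_ball, dist_zero_right]
    nlinarith [norm_nonneg (g x)]
  have key := schwarz_pick hgd hgm hz hw
  have h1 := norm_pos_iff.2 (hne z hz)
  have h2 := norm_pos_iff.2 (hne w hw)
  have hd : ‖g z - g w‖ = 2 * ‖G z - G w‖ / (‖G z + 1‖ * ‖G w + 1‖) := by
    rw [← norm_mul, show (2 : ℝ) = ‖(2 : ℂ)‖ by simp, ← norm_mul, ← norm_div]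
    congr 1
    simp only [hg]
    have := hne z hz
    have := hne w hw
    field_simp
    ring
  rw [hsq z hz, hsq w hw, hd] at key
  have e1 : (2 * ‖G z - G w‖ / (‖G z + 1‖ * ‖G w + 1‖)) ^ 2 * ((1 - ‖z‖ ^ 2) * (1 - ‖w‖ ^ 2)) =
      4 * (‖G z - G w‖ ^ 2 * ((1 - ‖z‖ ^ 2) * (1 - ‖w‖ ^ 2))) / (‖G z + 1‖ * ‖G w + 1‖) ^ 2 := by
    ring
  have e2 : ‖z - w‖ ^ 2 * (4 * (G z).re / ‖G z + 1‖ ^ 2 * (4 * (G w).re / ‖G w + 1‖ ^ 2)) =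
      4 * (4 * ‖z - w‖ ^ 2 * ((G z).re * (G w).re)) / (‖G z + 1‖ * ‖G w + 1‖) ^ 2 := by
    field_simp
  rw [e1, e2, div_le_div_iff_of_pos_right (by positivity)] at key
  linarith

/-- The infinitesimal Schwarz–Pick inequality for functions of positive real part. -/
theorem norm_deriv_mul_le_re {G : ℂ → ℂ} (hG : DifferentiableOn ℂ G (Metric.ball 0 1))
    (hpos : ∀ z : ℂ, ‖z‖ < 1 → 0 < (G z).re) {z : ℂ} (hz : ‖z‖ < 1) :
    ‖deriv G z‖ * (1 - ‖z‖ ^ 2) ≤ 2 * (G z).re := by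
  have hmem : Metric.ball (0 : ℂ) 1 ∈ nhds z := Metric.isOpen_ball.mem_nhds (by simpa using hz)
  have hd := (hG.differentiableAt hmem)
  have hs := hasDerivAt_iff_tendsto_slope.1 hd.hasDerivAt
  have hE : 0 < 1 - ‖z‖ ^ 2 := by nlinarith [norm_nonneg z]
  -- The two-point inequality is divided by `|w - z|²`, and then `w → z`.
  have h1 : Filter.Tendsto (fun w => ‖slope G z w‖ ^ 2 * ((1 - ‖w‖ ^ 2) * (1 - ‖z‖ ^ 2)))
      (nhdsWithin z {z}ᶜ) (nhds (‖deriv G z‖ ^ 2 * ((1 - ‖z‖ ^ 2) * (1 - ‖z‖ ^ 2)))) := by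
    refine (hs.norm.pow 2).mul ?_
    have : Continuous fun w : ℂ => (1 - ‖w‖ ^ 2) * (1 - ‖z‖ ^ 2) := by fun_prop
    exact (this.tendsto z).mono_left nhdsWithin_le_nhds
  have h2 : Filter.Tendsto (fun w => 4 * ((G w).re * (G z).re))
      (nhdsWithin z {z}ᶜ) (nhds (4 * ((G z).re * (G z).re))) := by
    refine Filter.Tendsto.mono_left ?_ nhdsWithin_le_nhds
    exact (((Complex.continuous_re.tendsto _).comp hd.continuousAt).mul_const _).const_mul _
  have h3 := le_of_tendsto_of_tendsto h1 h2 (by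
    filter_upwards [self_mem_nhdsWithin, nhdsWithin_le_nhds hmem] with w hw hw1
    have hw1 : ‖w‖ < 1 := by simpa using hw1
    have h0 : 0 < ‖w - z‖ := norm_pos_iff.2 (sub_ne_zero.2 hw)
    have := schwarz_pick_re hG hpos hw1 hz
    rw [slope_def_field, norm_div, div_pow, div_mul_eq_mul_div, div_le_iff₀ (by positivity)]
    linarith)
  refine le_of_sq_le_sq ?_ (by linarith [hpos z hz])
  nlinarith

/-- This is Schwarz–Pick against the base point `0`. It is the bound that rules out `m_k > m_ℓ` at
the end. -/
theorem one_sub_norm_ge_of_mapsTo_ball {φ : ℂ → ℂ} (hφ : DifferentiableOn ℂ φ (Metric.ball 0 1))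
    (hmaps : Set.MapsTo φ (Metric.ball 0 1) (Metric.ball 0 1)) :
    ∃ c : ℝ, 0 < c ∧ ∀ z : ℂ, ‖z‖ < 1 → c * (1 - ‖z‖) ≤ 1 - ‖φ z‖ := by
  have hmaps' : ∀ {x : ℂ}, ‖x‖ < 1 → ‖φ x‖ < 1 := fun {x} hx => by
    simpa using hmaps (show x ∈ Metric.ball (0 : ℂ) 1 by simpa using hx)
  have h0 : ‖φ 0‖ < 1 := hmaps' (by simp)
  refine ⟨(1 - ‖φ 0‖) ^ 2 / 2, by have := sub_pos.2 h0; positivity, fun z hz => ?_⟩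
  have h1 := hmaps' hz
  have key := schwarz_pick hφ hmaps hz (w := 0) (by simp)
  have h2 : ‖1 - (starRingEnd ℂ) (φ 0) * φ z‖ ^ 2 * (1 - ‖z‖ ^ 2) ≤
      (1 - ‖φ z‖ ^ 2) * (1 - ‖φ 0‖ ^ 2) := by
    rw [norm_one_sub_conj_mul_sq]
    simp only [norm_zero, sub_zero] at key
    nlinarith
  have h3 : 1 - ‖φ 0‖ ≤ ‖1 - (starRingEnd ℂ) (φ 0) * φ z‖ := by
    have := norm_sub_norm_le (1 : ℂ) ((starRingEnd ℂ) (φ 0) * φ z)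
    rw [norm_one, norm_mul, RCLike.norm_conj] at this
    nlinarith [norm_nonneg (φ 0), norm_nonneg (φ z)]
  have h4 : (1 - ‖φ 0‖) ^ 2 ≤ ‖1 - (starRingEnd ℂ) (φ 0) * φ z‖ ^ 2 :=
    pow_le_pow_left₀ (sub_nonneg.2 h0.le) h3 2
  have h5 : 1 - ‖z‖ ≤ 1 - ‖z‖ ^ 2 := by nlinarith [norm_nonneg z]
  have h6 : (1 - ‖φ z‖ ^ 2) * (1 - ‖φ 0‖ ^ 2) ≤ 2 * (1 - ‖φ z‖) := by
    have : 1 - ‖φ z‖ ^ 2 ≤ 2 * (1 - ‖φ z‖) := by nlinarith [norm_nonneg (φ z)]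
    nlinarith [sq_nonneg ‖φ 0‖, norm_nonneg (φ z), mul_nonneg (sub_nonneg.2 h1.le) (sq_nonneg ‖φ 0‖)]
  have h7 : (1 - ‖φ 0‖) ^ 2 * (1 - ‖z‖) ≤ 2 * (1 - ‖φ z‖) :=
    calc _ ≤ ‖1 - (starRingEnd ℂ) (φ 0) * φ z‖ ^ 2 * (1 - ‖z‖ ^ 2) :=
          mul_le_mul h4 h5 (by linarith) (by positivity)
      _ ≤ _ := h2.trans h6
  linarith

/-! ### Stolz regions and the Julia–Carathéodory theorem -/

open Filter Topology in
/-- A radial approach to the boundary stays in every Stolz region with `M > 1`. -/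
theorem tendsto_radial_stolz {ζ : ℂ} (hζ : ‖ζ‖ = 1) {M : ℝ} (hM : 1 < M) :
    Tendsto (fun r : ℝ => (r : ℂ) * ζ) (𝓝[<] 1)
      (𝓝[{z : ℂ | ‖z‖ < 1 ∧ ‖z - ζ‖ < M * (1 - ‖z‖)}] ζ) := by
  refine tendsto_nhdsWithin_iff.2 ⟨?_, ?_⟩
  · have : Continuous fun r : ℝ => (r : ℂ) * ζ := by fun_prop
    simpa using (this.tendsto 1).mono_left nhdsWithin_le_nhds
  · filter_upwards [Ioo_mem_nhdsLT (show (0 : ℝ) < 1 by norm_num)] with r hr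
    have h1 : ‖(r : ℂ) * ζ‖ = r := by
      rw [norm_mul, hζ, mul_one, Complex.norm_real, Real.norm_of_nonneg hr.1.le]
    have h2 : ‖(r : ℂ) * ζ - ζ‖ = 1 - r := by
      rw [show (r : ℂ) * ζ - ζ = ((r - 1 : ℝ) : ℂ) * ζ by push_cast; ring, norm_mul, hζ, mul_one,
        Complex.norm_real, Real.norm_of_nonpos (by linarith [hr.2])]
      ring
    refine ⟨by rw [h1]; exact hr.2, ?_⟩
    rw [h1, h2]
    nlinarith [hr.2]

open Filter Topology in
theorem HasNontangentialLimit.tendsto_radial {f : ℂ → ℂ} {ζ L : ℂ}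
    (h : HasNontangentialLimit f ζ L) (hζ : ‖ζ‖ = 1) :
    Tendsto (fun r : ℝ => f (r * ζ)) (𝓝[<] 1) (𝓝 L) :=
  (h 2).comp (tendsto_radial_stolz hζ (by norm_num))

open Filter Topology in
theorem norm_ofReal_mul_eventually {ζ : ℂ} (hζ : ‖ζ‖ = 1) :
    ∀ᶠ r : ℝ in 𝓝[<] 1, 0 < r ∧ r < 1 ∧ ‖(r : ℂ) * ζ‖ = r ∧ ‖(r : ℂ) * ζ - ζ‖ = 1 - r := by
  filter_upwards [Ioo_mem_nhdsLT (show (0 : ℝ) < 1 by norm_num)] with r hr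
  refine ⟨hr.1, hr.2, ?_, ?_⟩
  · rw [norm_mul, hζ, mul_one, Complex.norm_real, Real.norm_of_nonneg hr.1.le]
  · rw [show (r : ℂ) * ζ - ζ = ((r - 1 : ℝ) : ℂ) * ζ by push_cast; ring, norm_mul, hζ, mul_one,
      Complex.norm_real, Real.norm_of_nonpos (by linarith [hr.2])]
    ring

open Filter Topology in
/-- Julia's inequality. -/
theorem julia_inequality {φ : ℂ → ℂ} (hφ : DifferentiableOn ℂ φ (Metric.ball 0 1))
    (hmaps : Set.MapsTo φ (Metric.ball 0 1) (Metric.ball 0 1)) {ζ η : ℂ} (hζ : ‖ζ‖ = 1)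
    (hlim : Tendsto (fun r : ℝ => φ (r * ζ)) (𝓝[<] 1) (𝓝 η)) {A : ℝ}
    (hbd : ∀ᶠ r : ℝ in 𝓝[<] 1, 1 - ‖φ (r * ζ)‖ ≤ A * (1 - r)) {z : ℂ} (hz : ‖z‖ < 1) :
    ‖φ z - η‖ ^ 2 * (1 - ‖z‖ ^ 2) ≤ A * (‖z - ζ‖ ^ 2 * (1 - ‖φ z‖ ^ 2)) := by
  have hmaps' : ∀ {x : ℂ}, ‖x‖ < 1 → ‖φ x‖ < 1 := fun {x} hx => by
    simpa using hmaps (show x ∈ Metric.ball (0 : ℂ) 1 by simpa using hx)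
  -- Schwarz–Pick for `z` and `rζ`, with `1 - r` cancelled from `1 - r² = (1 - r)(1 + r)`, in the
  -- limit `r → 1`. The leftover `1 + r → 2` matches the `2 A` on the other side.
  have h1 : Tendsto (fun r : ℝ => ‖φ z - φ (r * ζ)‖ ^ 2 * (1 - ‖z‖ ^ 2) * (1 + r)) (𝓝[<] 1)
      (𝓝 (‖φ z - η‖ ^ 2 * (1 - ‖z‖ ^ 2) * (1 + 1))) := by
    refine (((tendsto_const_nhds.sub hlim).norm.pow 2).mul_const _).mul ?_
    exact tendsto_const_nhds.add (tendsto_id.mono_left nhdsWithin_le_nhds)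
  have h2 : Tendsto (fun r : ℝ => ‖z - r * ζ‖ ^ 2 * (1 - ‖φ z‖ ^ 2) * (2 * A)) (𝓝[<] 1)
      (𝓝 (‖z - ζ‖ ^ 2 * (1 - ‖φ z‖ ^ 2) * (2 * A))) := by
    have : Continuous fun r : ℝ => ‖z - r * ζ‖ ^ 2 * (1 - ‖φ z‖ ^ 2) * (2 * A) := by fun_prop
    simpa using (this.tendsto 1).mono_left (nhdsWithin_le_nhds (s := Set.Iio 1))
  have h3 := le_of_tendsto_of_tendsto h1 h2 (by
    filter_upwards [hbd, norm_ofReal_mul_eventually hζ] with r hr ⟨hr0, hr1, hn, _⟩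
    have hr' : ‖(r : ℂ) * ζ‖ < 1 := by rw [hn]; exact hr1
    have key := schwarz_pick hφ hmaps hz hr'
    rw [hn] at key
    have h4 := hmaps' hr'
    have h5 := hmaps' hz
    have h6 : 1 - ‖φ (r * ζ)‖ ^ 2 ≤ 2 * A * (1 - r) := by
      nlinarith [norm_nonneg (φ (r * ζ))]
    have h7 : 0 ≤ ‖z - r * ζ‖ ^ 2 * (1 - ‖φ z‖ ^ 2) :=
      mul_nonneg (sq_nonneg _) (by nlinarith [norm_nonneg (φ z)])
    have h8 := mul_le_mul_of_nonneg_left h6 h7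
    refine le_of_mul_le_mul_right ?_ (sub_pos.2 hr1)
    calc _ = ‖φ z - φ (r * ζ)‖ ^ 2 * ((1 - ‖z‖ ^ 2) * (1 - r ^ 2)) := by ring
      _ ≤ _ := key
      _ = ‖z - r * ζ‖ ^ 2 * (1 - ‖φ z‖ ^ 2) * (1 - ‖φ (r * ζ)‖ ^ 2) := by ring
      _ ≤ _ := h8
      _ = _ := by ring)
  linarith

open Filter Topology in
/-- A function of positive real part whose real part at one point is small compared with the
Poisson kernel at `ζ` grows slowly in every Stolz region at `ζ`. -/
theorem eventually_norm_mul_le_of_re_pos {G : ℂ → ℂ}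
    (hG : DifferentiableOn ℂ G (Metric.ball 0 1)) (hpos : ∀ z : ℂ, ‖z‖ < 1 → 0 < (G z).re)
    {ζ w : ℂ} (hζ : ‖ζ‖ = 1) (hw : ‖w‖ < 1) {δ M : ℝ} (hδ : 0 < δ) (hM : 0 < M)
    (hsmall : (G w).re * ‖ζ - w‖ ^ 2 ≤ 2 * δ * (1 - ‖w‖ ^ 2)) :
    ∀ᶠ z in 𝓝[{z : ℂ | ‖z‖ < 1 ∧ ‖z - ζ‖ < M * (1 - ‖z‖)}] ζ,
      ‖ζ - z‖ * ‖G z‖ ≤ (2 + 16 * M) * δ := by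
  have hζw : 0 < ‖ζ - w‖ := norm_pos_iff.2 (sub_ne_zero.2 fun h => by rw [← h, hζ] at hw; simp at hw)
  have e1 : ∀ᶠ z in 𝓝 ζ, ‖z - w‖ ^ 2 < 2 * ‖ζ - w‖ ^ 2 := by
    have : Continuous fun z : ℂ => ‖z - w‖ ^ 2 := by fun_prop
    exact (this.tendsto ζ).eventually (gt_mem_nhds (by nlinarith [pow_pos hζw 2]))
  have e2 : ∀ᶠ z in 𝓝 ζ, ‖ζ - z‖ * ‖G w‖ < δ := by
    have : Continuous fun z : ℂ => ‖ζ - z‖ * ‖G w‖ := by fun_prop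
    exact (this.tendsto ζ).eventually (gt_mem_nhds (by simpa using hδ))
  filter_upwards [nhdsWithin_le_nhds e1, nhdsWithin_le_nhds e2, self_mem_nhdsWithin]
    with z h1 h2 ⟨hz, hzM⟩
  set x := ‖ζ - z‖ * ‖G z‖ with hx
  have hx0 : 0 ≤ x := by positivity
  have key := schwarz_pick_re hG hpos hz hw
  have hEz : 0 < 1 - ‖z‖ ^ 2 := by nlinarith [norm_nonneg z]
  have hEw : 0 < 1 - ‖w‖ ^ 2 := by nlinarith [norm_nonneg w]
  have hre : (G z).re ≤ ‖G z‖ := Complex.re_le_norm _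
  have hdist : ‖ζ - z‖ ≤ M * (1 - ‖z‖ ^ 2) := by
    rw [norm_sub_rev]
    refine hzM.le.trans (mul_le_mul_of_nonneg_left ?_ hM.le)
    nlinarith [norm_nonneg z]
  have hz0 : 0 < ‖ζ - z‖ := norm_pos_iff.2 (sub_ne_zero.2 fun h => by rw [← h, hζ] at hz; simp at hz)
  have k1 : ‖G z - G w‖ ^ 2 * (1 - ‖z‖ ^ 2) ≤ 16 * δ * ‖G z‖ := by
    refine le_of_mul_le_mul_right ?_ (mul_pos hEw (pow_pos hζw 2))
    calc ‖G z - G w‖ ^ 2 * (1 - ‖z‖ ^ 2) * ((1 - ‖w‖ ^ 2) * ‖ζ - w‖ ^ 2)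
        = ‖G z - G w‖ ^ 2 * ((1 - ‖z‖ ^ 2) * (1 - ‖w‖ ^ 2)) * ‖ζ - w‖ ^ 2 := by ring
      _ ≤ 4 * ‖z - w‖ ^ 2 * ((G z).re * (G w).re) * ‖ζ - w‖ ^ 2 := by gcongr
      _ = 4 * ‖z - w‖ ^ 2 * (G z).re * ((G w).re * ‖ζ - w‖ ^ 2) := by ring
      _ ≤ 4 * (2 * ‖ζ - w‖ ^ 2) * ‖G z‖ * (2 * δ * (1 - ‖w‖ ^ 2)) := by
          have := hpos z hz
          have := hpos w hw
          gcongr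
      _ = _ := by ring
  have k2 : (‖ζ - z‖ * ‖G z - G w‖) ^ 2 ≤ 16 * δ * M * x := by
    have hstep : ‖ζ - z‖ * (‖G z - G w‖ ^ 2 * ‖ζ - z‖) ≤ ‖ζ - z‖ * (16 * δ * M * ‖G z‖) := by
      refine mul_le_mul_of_nonneg_left ?_ hz0.le
      calc _ ≤ ‖G z - G w‖ ^ 2 * (M * (1 - ‖z‖ ^ 2)) := by gcongr
        _ = M * (‖G z - G w‖ ^ 2 * (1 - ‖z‖ ^ 2)) := by ring
        _ ≤ M * (16 * δ * ‖G z‖) := by gcongr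
        _ = _ := by ring
    calc _ = ‖ζ - z‖ * (‖G z - G w‖ ^ 2 * ‖ζ - z‖) := by ring
      _ ≤ _ := hstep
      _ = _ := by rw [hx]; ring
  have k3 : x - δ ≤ ‖ζ - z‖ * ‖G z - G w‖ := by
    have := mul_le_mul_of_nonneg_left (norm_sub_norm_le (G z) (G w)) hz0.le
    rw [mul_sub] at this
    linarith
  -- Squaring `k3` needs `x ≥ δ`. In that case `(x - δ)² ≤ 16 δ M x` yields `x² ≤ (2 + 16 M) δ x`.
  by_cases hxδ : x ≤ δ
  · nlinarith [mul_pos hM hδ]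
  · have k4 : (x - δ) ^ 2 ≤ 16 * δ * M * x :=
      (pow_le_pow_left₀ (by linarith) k3 2).trans k2
    have hxpos : 0 < x := hδ.trans (not_le.1 hxδ)
    refine le_of_mul_le_mul_right ?_ hxpos
    nlinarith [sq_nonneg δ]

/-- The right side is the Poisson kernel at `ζ`. It turns Julia's inequality into a comparison of
real parts of two Cayley transforms. -/
theorem re_add_div_sub {ζ w : ℂ} (hζ : ‖ζ‖ = 1) :
    ((ζ + w) / (ζ - w)).re = (1 - ‖w‖ ^ 2) / ‖ζ - w‖ ^ 2 := by
  have h : ζ.re * ζ.re + ζ.im * ζ.im = 1 := by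
    rw [← Complex.normSq_apply, Complex.normSq_eq_norm_sq, hζ, one_pow]
  rw [Complex.div_re, ← add_div, Complex.normSq_eq_norm_sq]
  congr 1
  rw [← Complex.normSq_eq_norm_sq]
  simp only [Complex.add_re, Complex.add_im, Complex.sub_re, Complex.sub_im, Complex.normSq_apply]
  linear_combination h

open Filter Topology in
/-- The Julia–Carathéodory theorem for a radially approached boundary point. -/
theorem hasAngularDerivative_of_one_sub_norm_le {φ : ℂ → ℂ}
    (hφ : DifferentiableOn ℂ φ (Metric.ball 0 1))
    (hmaps : Set.MapsTo φ (Metric.ball 0 1) (Metric.ball 0 1)) {ζ η : ℂ} (hζ : ‖ζ‖ = 1)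
    (hη : ‖η‖ = 1) (hlim : HasNontangentialLimit φ ζ η) {A : ℝ}
    (hbd : ∀ᶠ r : ℝ in 𝓝[<] 1, 1 - ‖φ (r * ζ)‖ ≤ A * (1 - r)) :
    HasAngularDerivative φ ζ := by
  refine ⟨⟨η, hlim, hη⟩, ?_⟩
  have hmaps' : ∀ {x : ℂ}, ‖x‖ < 1 → ‖φ x‖ < 1 := fun {x} hx => by
    simpa using hmaps (show x ∈ Metric.ball (0 : ℂ) 1 by simpa using hx)
  set B := max A 1 with hB
  have hB0 : 0 < B := lt_max_of_lt_right one_pos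
  have hbd' : ∀ᶠ r : ℝ in 𝓝[<] 1, 1 - ‖φ (r * ζ)‖ ≤ B * (1 - r) := by
    filter_upwards [hbd, norm_ofReal_mul_eventually hζ] with r hr ⟨_, hr1, _⟩
    exact hr.trans (mul_le_mul_of_nonneg_right (le_max_left _ _) (by linarith))
  have hne : ∀ {ξ z : ℂ}, ‖ξ‖ = 1 → ‖z‖ < 1 → ξ - z ≠ 0 := fun hξ hz =>
    sub_ne_zero.2 fun h => by rw [← h, hξ] at hz; simp at hz
  set F : ℂ → ℂ := fun z => (η + φ z) / (η - φ z) with hF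
  set P : ℂ → ℂ := fun z => (ζ + z) / (ζ - z) with hP
  have hFd : DifferentiableOn ℂ F (Metric.ball 0 1) :=
    (hφ.const_add _).div (hφ.const_sub _) fun z hz => hne hη (hmaps' (by simpa using hz))
  have hPd : DifferentiableOn ℂ P (Metric.ball 0 1) :=
    (differentiableOn_id.const_add _).div (differentiableOn_id.const_sub _)
      fun z hz => hne hζ (by simpa using hz)
  have hPre : ∀ z : ℂ, ‖z‖ < 1 → 0 < (P z).re := fun z hz => by
    simp only [hP]
    rw [re_add_div_sub hζ]
    have := norm_pos_iff.2 (hne hζ hz)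
    have : 0 < 1 - ‖z‖ ^ 2 := by nlinarith [norm_nonneg z]
    positivity
  set S : Set ℝ := (fun z => (F z).re / (P z).re) '' {z : ℂ | ‖z‖ < 1} with hS
  have hSlow : ∀ y ∈ S, 1 / B ≤ y := by
    rintro _ ⟨z, hz, rfl⟩
    have hz : ‖z‖ < 1 := hz
    have key := julia_inequality hφ hmaps hζ (hlim.tendsto_radial hζ) hbd' hz
    have h1 := norm_pos_iff.2 (hne hζ hz)
    have h2 := norm_pos_iff.2 (hne hη (hmaps' hz))
    simp only
    rw [div_le_div_iff₀ hB0 (hPre z hz)]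
    simp only [hF, hP]
    rw [re_add_div_sub hζ, re_add_div_sub hη, one_mul, div_mul_eq_mul_div,
      div_le_div_iff₀ (by positivity) (by positivity), norm_sub_rev ζ, norm_sub_rev η]
    linarith
  have hSbdd : BddBelow S := ⟨1 / B, hSlow⟩
  have hSne : S.Nonempty := ⟨_, ⟨0, by simp, rfl⟩⟩
  -- `c` is the largest constant with `Re F ≥ c Re P`; Julia's inequality makes it positive.
  set c := sInf S with hc
  have hcpos : 0 < c := lt_of_lt_of_le (by positivity) (le_csInf hSne hSlow)
  -- The value comes from `φ' = 2 η F' / (F + 1)²`, multiplied above and below by `(ζ - z)²`; both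
  -- `(ζ - z) F` and `(ζ - z)² F'` tend to `2 ζ c`.
  refine ⟨2 * η * (2 * ζ * c) / (2 * ζ * c) ^ 2, fun M => ?_⟩
  set l := 𝓝[{z : ℂ | ‖z‖ < 1 ∧ ‖z - ζ‖ < M * (1 - ‖z‖)}] ζ with hl
  have hlz : Tendsto (fun z : ℂ => z) l (𝓝 ζ) := tendsto_id.mono_left nhdsWithin_le_nhds
  have hmem : ∀ᶠ z in l, ‖z‖ < 1 ∧ ‖z - ζ‖ < M * (1 - ‖z‖) := self_mem_nhdsWithin
  have main : ∀ δ > 0, 0 < M → ∀ᶠ z in l, ‖(ζ - z) * F z - c * (ζ + z)‖ ≤ (4 + 16 * M) * δ ∧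
      ‖(ζ - z) ^ 2 * deriv F z - 2 * ζ * c‖ ≤ (2 * M * (2 + 16 * M) + 2) * δ := by
    intro δ hδ hM
    obtain ⟨_, ⟨w, hw, rfl⟩, hwc⟩ := exists_lt_of_csInf_lt hSne (show sInf S < c + δ by linarith)
    have hw : ‖w‖ < 1 := hw
    -- Lowering `c` to `c - δ` makes `Re G` strictly positive, while at the near-minimizer `w` it is
    -- at most `2 δ Re P`.
    set G : ℂ → ℂ := fun z => F z - ((c - δ : ℝ) : ℂ) * P z with hG
    have hGd : DifferentiableOn ℂ G (Metric.ball 0 1) := hFd.sub (hPd.const_mul _)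
    have hGre : ∀ z, (G z).re = (F z).re - (c - δ) * (P z).re := fun z => by
      simp only [hG, Complex.sub_re, Complex.re_ofReal_mul]
    have hGpos : ∀ z : ℂ, ‖z‖ < 1 → 0 < (G z).re := fun z hz => by
      have h1 : c ≤ (F z).re / (P z).re := csInf_le hSbdd ⟨z, hz, rfl⟩
      rw [le_div_iff₀ (hPre z hz)] at h1
      rw [hGre]
      nlinarith [mul_pos hδ (hPre z hz)]
    have hsmall : (G w).re * ‖ζ - w‖ ^ 2 ≤ 2 * δ * (1 - ‖w‖ ^ 2) := by
      have h1 := hwc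
      simp only at h1
      rw [div_lt_iff₀ (hPre w hw)] at h1
      have h2 : (G w).re ≤ 2 * δ * (P w).re := by rw [hGre]; linarith
      have h3 : (P w).re * ‖ζ - w‖ ^ 2 = 1 - ‖w‖ ^ 2 := by
        simp only [hP]
        rw [re_add_div_sub hζ, div_mul_cancel₀]
        exact pow_ne_zero _ (norm_ne_zero_iff.2 (hne hζ hw))
      calc _ ≤ 2 * δ * (P w).re * ‖ζ - w‖ ^ 2 := by gcongr
        _ = _ := by rw [mul_assoc, h3]
    filter_upwards [eventually_norm_mul_le_of_re_pos hGd hGpos hζ hw hδ hM hsmall, hmem]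
      with z hzG ⟨hz, hzM⟩
    have hz0 := hne hζ hz
    have hnhds : Metric.ball (0 : ℂ) 1 ∈ 𝓝 z := Metric.isOpen_ball.mem_nhds (by simpa using hz)
    have hPz : (ζ - z) * P z = ζ + z := mul_div_cancel₀ _ hz0
    have hPder : (ζ - z) ^ 2 * deriv P z = 2 * ζ := by
      have : HasDerivAt P ((1 * (ζ - z) - (ζ + z) * (-1)) / (ζ - z) ^ 2) z :=
        ((hasDerivAt_id z).const_add ζ).div ((hasDerivAt_id z).const_sub ζ) hz0
      rw [this.deriv, mul_div_cancel₀ _ (pow_ne_zero 2 hz0)]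
      ring
    have hGder : deriv G z = deriv F z - ((c - δ : ℝ) : ℂ) * deriv P z := by
      have hFz := hFd.differentiableAt hnhds
      have hPz := hPd.differentiableAt hnhds
      simp only [hG]
      rw [deriv_fun_sub hFz (hPz.const_mul _), deriv_const_mul _ hPz]
    constructor
    · have e : (ζ - z) * F z - c * (ζ + z) = (ζ - z) * G z - δ * (ζ + z) := by
        simp only [hG]; push_cast; linear_combination (c - δ : ℂ) * hPz
      have h2 : ‖(δ : ℂ) * (ζ + z)‖ ≤ 2 * δ := by
        rw [norm_mul, Complex.norm_real, Real.norm_of_nonneg hδ.le]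
        have := norm_add_le ζ z
        nlinarith
      rw [e]
      refine (norm_sub_le _ _).trans ?_
      rw [norm_mul]
      linarith
    · have e : (ζ - z) ^ 2 * deriv F z - 2 * ζ * c = (ζ - z) ^ 2 * deriv G z - δ * (2 * ζ) := by
        rw [hGder]; push_cast; linear_combination (c - δ : ℂ) * hPder
      have h2 : ‖(δ : ℂ) * (2 * ζ)‖ ≤ 2 * δ := by
        rw [norm_mul, Complex.norm_real, Real.norm_of_nonneg hδ.le, norm_mul, hζ]
        norm_num
        linarith
      have h3 : ‖deriv G z‖ * (1 - ‖z‖ ^ 2) ≤ 2 * ‖G z‖ :=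
        (norm_deriv_mul_le_re hGd hGpos hz).trans (by linarith [Complex.re_le_norm (G z)])
      have h4 : ‖ζ - z‖ ≤ M * (1 - ‖z‖ ^ 2) := by
        rw [norm_sub_rev]
        refine hzM.le.trans (mul_le_mul_of_nonneg_left ?_ hM.le)
        nlinarith [norm_nonneg z]
      have h5 : ‖(ζ - z) ^ 2 * deriv G z‖ ≤ 2 * M * ((2 + 16 * M) * δ) := by
        rw [norm_mul, norm_pow]
        calc ‖ζ - z‖ ^ 2 * ‖deriv G z‖ = ‖ζ - z‖ * (‖ζ - z‖ * ‖deriv G z‖) := by ring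
          _ ≤ ‖ζ - z‖ * ((M * (1 - ‖z‖ ^ 2)) * ‖deriv G z‖) := by gcongr
          _ = ‖ζ - z‖ * (M * (‖deriv G z‖ * (1 - ‖z‖ ^ 2))) := by ring
          _ ≤ ‖ζ - z‖ * (M * (2 * ‖G z‖)) := by
            gcongr
          _ = 2 * M * (‖ζ - z‖ * ‖G z‖) := by ring
          _ ≤ _ := by gcongr
      rw [e]
      refine (norm_sub_le _ _).trans ?_
      linarith
  -- For `M ≤ 0` the Stolz region is empty and the limit is vacuous.
  by_cases hM : 0 < M
  swap
  · have : l = ⊥ := by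
      have h1 : {z : ℂ | ‖z‖ < 1 ∧ ‖z - ζ‖ < M * (1 - ‖z‖)} = ∅ := by
        ext z
        simp only [Set.mem_ofPred_eq, Set.mem_empty_iff_false, iff_false, not_and, not_lt]
        intro hz
        nlinarith [norm_nonneg (z - ζ)]
      rw [hl, h1, nhdsWithin_empty]
    rw [this]
    exact tendsto_bot
  have lim_of : ∀ {H : ℂ → ℂ} {K : ℝ}, 0 < K → (∀ δ > 0, ∀ᶠ z in l, ‖H z‖ ≤ K * δ) →
      Tendsto H l (𝓝 0) := by
    intro H K hK h
    rw [Metric.tendsto_nhds]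
    intro ε hε
    filter_upwards [h (ε / (2 * K)) (by positivity)] with z hz
    rw [dist_zero_right]
    refine hz.trans_lt ?_
    field_simp
    norm_num
  have t1 : Tendsto (fun z => (ζ - z) * F z) l (𝓝 (2 * ζ * c)) := by
    have h1 := lim_of (H := fun z => (ζ - z) * F z - c * (ζ + z)) (K := 4 + 16 * M)
      (by positivity) fun δ hδ => (main δ hδ hM).mono fun z hz => hz.1
    have h2 : Tendsto (fun z : ℂ => (c : ℂ) * (ζ + z)) l (𝓝 (c * (ζ + ζ))) :=
      (hlz.const_add ζ).const_mul _
    have h3 := h1.add h2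
    rw [show (0 : ℂ) + c * (ζ + ζ) = 2 * ζ * c by ring] at h3
    exact h3.congr fun z => by ring
  have t2 : Tendsto (fun z => (ζ - z) ^ 2 * deriv F z) l (𝓝 (2 * ζ * c)) := by
    have h1 := lim_of (H := fun z => (ζ - z) ^ 2 * deriv F z - 2 * ζ * c)
      (K := 2 * M * (2 + 16 * M) + 2)
      (by positivity) fun δ hδ => (main δ hδ hM).mono fun z hz => hz.2
    have h3 := h1.add_const (2 * ζ * c : ℂ)
    rw [zero_add] at h3
    exact h3.congr fun z => by ring
  have hζ0 : ζ ≠ 0 := fun h => by simp [h] at hζ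
  have hη0 : η ≠ 0 := fun h => by simp [h] at hη
  have hc0 : (c : ℂ) ≠ 0 := by exact_mod_cast hcpos.ne'
  have t3 : Tendsto (fun z => ((ζ - z) * F z + (ζ - z)) ^ 2) l (𝓝 ((2 * ζ * c) ^ 2)) := by
    have h1 : Tendsto (fun z : ℂ => ζ - z) l (𝓝 0) := by
      simpa using hlz.const_sub ζ
    simpa using (t1.add h1).pow 2
  have t4 := (t2.const_mul (2 * η)).div t3
    (pow_ne_zero 2 (mul_ne_zero (mul_ne_zero two_ne_zero hζ0) hc0))
  refine t4.congr' ?_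
  filter_upwards [hmem] with z ⟨hz, _⟩
  have hnhds : Metric.ball (0 : ℂ) 1 ∈ 𝓝 z := Metric.isOpen_ball.mem_nhds (by simpa using hz)
  have hz0 := hne hζ hz
  have hφz := hne hη (hmaps' hz)
  have hφd := (hφ.differentiableAt hnhds).hasDerivAt
  have hFder : deriv F z = (deriv φ z * (η - φ z) - (η + φ z) * (-deriv φ z)) / (η - φ z) ^ 2 :=
    ((hφd.const_add η).div (hφd.const_sub η) hφz).deriv
  simp only [Pi.div_apply]
  have e1 : (ζ - z) * F z + (ζ - z) = (ζ - z) * (2 * η) / (η - φ z) := by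
    simp only [hF]
    field_simp
    ring
  rw [hFder, e1]
  field_simp
  ring

/-! ### Circle averages and the Hardy space -/

theorem DifferentiableOn.continuousOn_sphere {f : ℂ → ℂ}
    (hf : DifferentiableOn ℂ f (Metric.ball 0 1)) {r : ℝ} (hr : r ∈ Set.Ico (0 : ℝ) 1) :
    ContinuousOn f (Metric.sphere 0 |r|) := by
  refine hf.continuousOn.mono fun z hz => ?_
  rw [mem_sphere_zero_iff_norm, abs_of_nonneg hr.1] at hz
  rw [mem_ball_zero_iff, hz]
  exact hr.2

theorem norm_lt_one_of_mem_sphere {r : ℝ} (hr : r ∈ Set.Ico (0 : ℝ) 1) {z : ℂ}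
    (hz : z ∈ Metric.sphere (0 : ℂ) |r|) : ‖z‖ < 1 := by
  rw [mem_sphere_zero_iff_norm, abs_of_nonneg hr.1] at hz
  rw [hz]
  exact hr.2

theorem ContinuousOn.circleIntegrable_abs {E : Type*} [NormedAddCommGroup E] {f : ℂ → E} {c : ℂ}
    {r : ℝ} (hf : ContinuousOn f (Metric.sphere c |r|)) : CircleIntegrable f c r :=
  hf.circleIntegrable'

theorem DifferentiableOn.circleIntegrable_norm_sq {f : ℂ → ℂ}
    (hf : DifferentiableOn ℂ f (Metric.ball 0 1)) {r : ℝ} (hr : r ∈ Set.Ico (0 : ℝ) 1) :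
    CircleIntegrable (fun z => ‖f z‖ ^ 2) 0 r :=
  ((hf.continuousOn_sphere hr).norm.pow 2).circleIntegrable_abs

/-- The mean value property on circles inside the unit disc. -/
theorem DifferentiableOn.circleAverage_eq {f : ℂ → ℂ}
    (hf : DifferentiableOn ℂ f (Metric.ball 0 1)) {r : ℝ} (hr : r ∈ Set.Ico (0 : ℝ) 1) :
    Real.circleAverage f 0 r = f 0 := by
  refine DiffContOnCl.circleAverage (hf.mono fun z hz => ?_).diffContOnCl
  have h := Metric.closure_ball_subset_closedBall hz
  rw [mem_closedBall_zero_iff, abs_of_nonneg hr.1] at h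
  rw [mem_ball_zero_iff]
  exact h.trans_lt hr.2

theorem circleAverage_re {f : ℂ → ℂ} {r : ℝ} (hf : ContinuousOn f (Metric.sphere 0 |r|)) :
    Real.circleAverage (fun z => (f z).re) 0 r = (Real.circleAverage f 0 r).re :=
  Complex.reCLM.circleAverage_comp_comm hf.circleIntegrable_abs

theorem circleAverage_norm_sq_le_hardyNormSq {f : ℂ → ℂ} (hf : MemHardy f) {r : ℝ}
    (hr : r ∈ Set.Ico (0 : ℝ) 1) :
    Real.circleAverage (fun z => ‖f z‖ ^ 2) 0 r ≤ hardyNormSq f :=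
  le_ciSup hf.2 (⟨r, hr⟩ : Set.Ico (0 : ℝ) 1)

theorem hardyNormSq_le {f : ℂ → ℂ} {K : ℝ}
    (h : ∀ r ∈ Set.Ico (0 : ℝ) 1, Real.circleAverage (fun z => ‖f z‖ ^ 2) 0 r ≤ K) :
    hardyNormSq f ≤ K :=
  haveI : Nonempty (Set.Ico (0 : ℝ) 1) := ⟨⟨0, by simp⟩⟩
  ciSup_le fun r => h r r.2

theorem memHardy_of_circleAverage_le {f : ℂ → ℂ} (hf : DifferentiableOn ℂ f (Metric.ball 0 1))
    {K : ℝ} (h : ∀ r ∈ Set.Ico (0 : ℝ) 1, Real.circleAverage (fun z => ‖f z‖ ^ 2) 0 r ≤ K) :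
    MemHardy f :=
  ⟨hf, K, by rintro _ ⟨r, rfl⟩; exact h r r.2⟩

theorem memHardy_of_norm_le {f : ℂ → ℂ} (hf : DifferentiableOn ℂ f (Metric.ball 0 1)) {K : ℝ}
    (h : ∀ z : ℂ, ‖z‖ < 1 → ‖f z‖ ≤ K) : MemHardy f :=
  memHardy_of_circleAverage_le hf (K := K ^ 2) fun _ hr =>
    Real.circleAverage_mono_on_of_le_circle (hf.circleIntegrable_norm_sq hr) fun z hz =>
      pow_le_pow_left₀ (norm_nonneg _) (h z (norm_lt_one_of_mem_sphere hr hz)) 2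

theorem MemHardy.add {f g : ℂ → ℂ} (hf : MemHardy f) (hg : MemHardy g) :
    MemHardy fun z => f z + g z := by
  refine memHardy_of_circleAverage_le (hf.1.add hg.1)
    (K := 2 * hardyNormSq f + 2 * hardyNormSq g) fun r hr => ?_
  have h1 := hf.1.circleIntegrable_norm_sq hr
  have h2 := hg.1.circleIntegrable_norm_sq hr
  calc Real.circleAverage (fun z => ‖f z + g z‖ ^ 2) 0 r
      ≤ Real.circleAverage (fun z => (2 : ℝ) • ‖f z‖ ^ 2 + (2 : ℝ) • ‖g z‖ ^ 2) 0 r := by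
        refine Real.circleAverage_mono ((hf.1.add hg.1).circleIntegrable_norm_sq hr)
          ((h1.const_fun_smul (a := (2 : ℝ))).add (h2.const_fun_smul (a := (2 : ℝ)))) fun z _ => ?_
        have := norm_add_le (f z) (g z)
        simp only [smul_eq_mul]
        nlinarith [sq_nonneg (‖f z‖ - ‖g z‖), norm_nonneg (f z + g z)]
    _ = 2 * Real.circleAverage (fun z => ‖f z‖ ^ 2) 0 r +
          2 * Real.circleAverage (fun z => ‖g z‖ ^ 2) 0 r := by
        rw [Real.circleAverage_fun_add (h1.const_fun_smul (a := (2 : ℝ)))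
          (h2.const_fun_smul (a := (2 : ℝ))), Real.circleAverage_fun_smul,
          Real.circleAverage_fun_smul, smul_eq_mul, smul_eq_mul]
    _ ≤ _ := by
        linarith [circleAverage_norm_sq_le_hardyNormSq hf hr,
          circleAverage_norm_sq_le_hardyNormSq hg hr]

theorem MemHardy.mul_of_norm_le_one {b g : ℂ → ℂ} (hb : DifferentiableOn ℂ b (Metric.ball 0 1))
    (hb1 : ∀ z : ℂ, ‖z‖ < 1 → ‖b z‖ ≤ 1) (hg : MemHardy g) : MemHardy fun z => b z * g z := by
  refine memHardy_of_circleAverage_le (hb.mul hg.1) (K := hardyNormSq g) fun r hr => ?_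
  refine le_trans ?_ (circleAverage_norm_sq_le_hardyNormSq hg hr)
  refine Real.circleAverage_mono ((hb.mul hg.1).circleIntegrable_norm_sq hr)
    (hg.1.circleIntegrable_norm_sq hr) fun z hz => ?_
  simp only [norm_mul]
  refine pow_le_pow_left₀ (by positivity) ?_ 2
  exact mul_le_of_le_one_left (norm_nonneg _) (hb1 z (norm_lt_one_of_mem_sphere hr hz))

/-- Average `2 Re (conj (f 0) f) ≤ |f|² + |f 0|²`: the left side is harmonic with value `2 |f 0|²`
at the centre. -/
theorem norm_sq_le_circleAverage {f : ℂ → ℂ} (hf : DifferentiableOn ℂ f (Metric.ball 0 1)) {r : ℝ}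
    (hr : r ∈ Set.Ico (0 : ℝ) 1) : ‖f 0‖ ^ 2 ≤ Real.circleAverage (fun z => ‖f z‖ ^ 2) 0 r := by
  set L : ℂ → ℂ := fun z => 2 * ((starRingEnd ℂ) (f 0) * f z) with hL
  have hLd : DifferentiableOn ℂ L (Metric.ball 0 1) := (hf.const_mul _).const_mul _
  have hc := hLd.continuousOn_sphere hr
  have h1 : Real.circleAverage (fun z => (L z).re) 0 r = 2 * ‖f 0‖ ^ 2 := by
    rw [circleAverage_re hc, hLd.circleAverage_eq hr]
    simp only [hL, ← Complex.normSq_eq_conj_mul_self, Complex.normSq_eq_norm_sq]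
    norm_cast
  have h2 : Real.circleAverage (fun z => (L z).re) 0 r ≤
      Real.circleAverage (fun z => ‖f z‖ ^ 2 + ‖f 0‖ ^ 2) 0 r := by
    refine Real.circleAverage_mono (Complex.continuous_re.comp_continuousOn hc).circleIntegrable_abs
      (((hf.continuousOn_sphere hr).norm.pow 2).add continuousOn_const).circleIntegrable_abs
      fun z _ => ?_
    refine (Complex.re_le_norm _).trans ?_
    simp only [hL, norm_mul, RCLike.norm_conj, Complex.norm_ofNat]
    nlinarith [sq_nonneg (‖f z‖ - ‖f 0‖)]
  rw [Real.circleAverage_fun_add (hf.circleIntegrable_norm_sq hr)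
    (continuousOn_const.circleIntegrable_abs), Real.circleAverage_const, h1] at h2
  linarith

/-! ### Members of `H(b)`: multiples of the mate and constants -/

theorem deBrangesDefects_nonempty (b f : ℂ → ℂ) : (deBrangesDefects b f).Nonempty :=
  ⟨_, 0, memHardy_of_norm_le (K := 0) (differentiableOn_const 0) (by simp), rfl⟩

theorem deBrangesNorm_le_of_forall_le {b f : ℂ → ℂ} {K : ℝ} (h : ∀ t ∈ deBrangesDefects b f, t ≤ K) :
    deBrangesNorm b f ≤ Real.sqrt K :=
  Real.sqrt_le_sqrt (csSup_le (deBrangesDefects_nonempty b f) h)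

/-- If `|a|² + |b|² ≤ 1` on the disc, then `a H²` is contractively contained in `H(b)`. -/
theorem memDeBranges_mul {a b : ℂ → ℂ} (ha : DifferentiableOn ℂ a (Metric.ball 0 1))
    (hb : DifferentiableOn ℂ b (Metric.ball 0 1))
    (hab : ∀ z : ℂ, ‖z‖ < 1 → ‖a z‖ ^ 2 + ‖b z‖ ^ 2 ≤ 1)
    {q : ℂ → ℂ} (hq : MemHardy q) :
    MemDeBranges b (fun z => a z * q z) ∧
      ∀ t ∈ deBrangesDefects b (fun z => a z * q z), t ≤ hardyNormSq q := by
  have hbd : ∀ t ∈ deBrangesDefects b (fun z => a z * q z), t ≤ hardyNormSq q := by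
    rintro _ ⟨g, hg, rfl⟩
    rw [sub_le_iff_le_add]
    refine hardyNormSq_le fun r hr => ?_
    have h1 := hq.1.circleIntegrable_norm_sq hr
    have h2 := hg.1.circleIntegrable_norm_sq hr
    calc Real.circleAverage (fun z => ‖a z * q z + b z * g z‖ ^ 2) 0 r
        ≤ Real.circleAverage (fun z => ‖q z‖ ^ 2 + ‖g z‖ ^ 2) 0 r := by
          refine Real.circleAverage_mono
            (((ha.mul hq.1).add (hb.mul hg.1)).circleIntegrable_norm_sq hr) (h1.add h2)
            fun z hz => ?_
          have h3 := hab z (norm_lt_one_of_mem_sphere hr hz)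
          have h4 := norm_add_le (a z * q z) (b z * g z)
          rw [norm_mul, norm_mul] at h4
          -- Pointwise Cauchy–Schwarz for the vectors `(a, b)` and `(q, g)`.
          calc ‖a z * q z + b z * g z‖ ^ 2 ≤ (‖a z‖ * ‖q z‖ + ‖b z‖ * ‖g z‖) ^ 2 :=
                pow_le_pow_left₀ (norm_nonneg _) h4 2
            _ ≤ (‖a z‖ ^ 2 + ‖b z‖ ^ 2) * (‖q z‖ ^ 2 + ‖g z‖ ^ 2) := by
                nlinarith [sq_nonneg (‖a z‖ * ‖g z‖ - ‖b z‖ * ‖q z‖)]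
            _ ≤ _ := mul_le_of_le_one_left (by positivity) h3
      _ ≤ _ := by
          rw [Real.circleAverage_fun_add h1 h2]
          exact add_le_add (circleAverage_norm_sq_le_hardyNormSq hq hr)
            (circleAverage_norm_sq_le_hardyNormSq hg hr)
  refine ⟨⟨hq.mul_of_norm_le_one ha fun z hz => ?_, _, hbd⟩, hbd⟩
  nlinarith [hab z hz, sq_nonneg ‖b z‖, norm_nonneg (a z)]

/-- The constants belong to `H(b)` as soon as `b` has a nontrivial mate. -/
theorem memDeBranges_one {a b : ℂ → ℂ} (ha : DifferentiableOn ℂ a (Metric.ball 0 1))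
    (hb : DifferentiableOn ℂ b (Metric.ball 0 1))
    (hab : ∀ z : ℂ, ‖z‖ < 1 → ‖a z‖ ^ 2 + ‖b z‖ ^ 2 ≤ 1)
    (ha0 : a 0 ≠ 0) : MemDeBranges b (fun _ => 1) := by
  have h1H : MemHardy fun _ => (1 : ℂ) :=
    memHardy_of_norm_le (K := 1) (differentiableOn_const 1) (by simp)
  -- Pointwise `|1 + b g|² + |a g|² ≤ 1 + 2 Re (b g) + |g|²`. Averaging leaves `1 + 2 |b 0| |g 0| -
  -- |a 0|² |g 0|²`, and completing the square in `|g 0|` gives the constant.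
  refine ⟨h1H, 1 + (‖b 0‖ / ‖a 0‖) ^ 2, ?_⟩
  rintro _ ⟨g, hg, rfl⟩
  rw [sub_le_iff_le_add]
  refine hardyNormSq_le fun r hr => ?_
  have hagd : DifferentiableOn ℂ (fun z => a z * g z) (Metric.ball 0 1) := ha.mul hg.1
  have hbgd : DifferentiableOn ℂ (fun z => b z * g z) (Metric.ball 0 1) := hb.mul hg.1
  have hga := hagd.circleIntegrable_norm_sq hr
  have hgg := hg.1.circleIntegrable_norm_sq hr
  set L : ℂ → ℂ := fun z => 1 + 2 * (b z * g z) with hL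
  have hLd : DifferentiableOn ℂ L (Metric.ball 0 1) := (hbgd.const_mul _).const_add _
  have hc := hLd.continuousOn_sphere hr
  have hcre : CircleIntegrable (fun z => (L z).re) 0 r :=
    (Complex.continuous_re.comp_continuousOn hc).circleIntegrable_abs
  have key : Real.circleAverage (fun z => ‖1 + b z * g z‖ ^ 2 + ‖a z * g z‖ ^ 2) 0 r ≤
      Real.circleAverage (fun z => (L z).re + ‖g z‖ ^ 2) 0 r := by
    refine Real.circleAverage_mono
      (((hbgd.const_add 1).circleIntegrable_norm_sq hr).add hga) (hcre.add hgg) fun z hz => ?_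
    have h3 := hab z (norm_lt_one_of_mem_sphere hr hz)
    have h4 : ‖1 + b z * g z‖ ^ 2 = (L z).re + ‖b z * g z‖ ^ 2 := by
      simp only [hL, ← Complex.normSq_eq_norm_sq, Complex.normSq_apply, Complex.add_re,
        Complex.add_im, Complex.one_re, Complex.one_im]
      simp
      ring
    rw [h4, norm_mul, norm_mul, mul_pow, mul_pow]
    nlinarith [mul_le_mul_of_nonneg_right h3 (sq_nonneg ‖g z‖)]
  rw [Real.circleAverage_fun_add ((hbgd.const_add 1).circleIntegrable_norm_sq hr) hga,
    Real.circleAverage_fun_add hcre hgg, circleAverage_re hc, hLd.circleAverage_eq hr] at key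
  have h5 := norm_sq_le_circleAverage hagd hr
  have h6 := circleAverage_norm_sq_le_hardyNormSq hg hr
  have h7 : (L 0).re ≤ 1 + 2 * (‖b 0‖ * ‖g 0‖) := by
    simp only [hL, Complex.add_re, Complex.one_re]
    refine add_le_add_right ((Complex.re_le_norm _).trans ?_) 1
    simp
  have h8 : 2 * (‖b 0‖ * ‖g 0‖) - ‖a 0 * g 0‖ ^ 2 ≤ (‖b 0‖ / ‖a 0‖) ^ 2 := by
    have ha' := norm_pos_iff.2 ha0
    have : ‖b 0‖ * ‖g 0‖ = ‖b 0‖ / ‖a 0‖ * (‖a 0‖ * ‖g 0‖) := by field_simp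
    rw [norm_mul, this]
    nlinarith [sq_nonneg (‖b 0‖ / ‖a 0‖ - ‖a 0‖ * ‖g 0‖)]
  linarith

/-- The square of the Hardy space norm of the Szegő kernel. -/
theorem hardyNormSq_szego_le {w : ℂ} (hw : ‖w‖ < 1) :
    MemHardy (fun z => (1 - (starRingEnd ℂ) w * z)⁻¹) ∧
      hardyNormSq (fun z => (1 - (starRingEnd ℂ) w * z)⁻¹) ≤ (1 - ‖w‖ ^ 2)⁻¹ := by
  have hne : ∀ z : ℂ, ‖z‖ < 1 → 1 - (starRingEnd ℂ) w * z ≠ 0 := fun z hz =>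
    one_sub_conj_mul_ne_zero hz hw
  have hk : DifferentiableOn ℂ (fun z => (1 - (starRingEnd ℂ) w * z)⁻¹) (Metric.ball 0 1) :=
    ((differentiableOn_const 1).sub (differentiableOn_id.const_mul _)).inv fun z hz =>
      hne z (by simpa using hz)
  have hE : 0 < 1 - ‖w‖ ^ 2 := by nlinarith [norm_nonneg w]
  have hbound : ∀ r ∈ Set.Ico (0 : ℝ) 1, Real.circleAverage
      (fun z => ‖(1 - (starRingEnd ℂ) w * z)⁻¹‖ ^ 2) 0 r ≤ (1 - ‖w‖ ^ 2)⁻¹ := by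
    intro r hr
    -- `Re L` is a harmonic majorant of the squared modulus of the kernel, so its value at `0`
    -- bounds every circle average.
    set L : ℂ → ℂ := fun z => ((1 - ‖w‖ ^ 2 : ℝ) : ℂ)⁻¹ *
      (2 * (1 - (starRingEnd ℂ) w * z)⁻¹ - 1) with hL
    have hLd : DifferentiableOn ℂ L (Metric.ball 0 1) := ((hk.const_mul _).sub_const _).const_mul _
    have hc := hLd.continuousOn_sphere hr
    have h1 : Real.circleAverage (fun z => (L z).re) 0 r = (1 - ‖w‖ ^ 2)⁻¹ := by
      rw [circleAverage_re hc, hLd.circleAverage_eq hr]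
      simp only [hL, mul_zero, sub_zero, inv_one, mul_one]
      rw [← Complex.ofReal_inv, Complex.re_ofReal_mul]
      norm_num
    rw [← h1]
    refine Real.circleAverage_mono (hk.circleIntegrable_norm_sq hr)
      (Complex.continuous_re.comp_continuousOn hc).circleIntegrable_abs fun z hz => ?_
    have hz1 := norm_lt_one_of_mem_sphere hr hz
    set v := 1 - (starRingEnd ℂ) w * z with hv
    have hv0 := norm_pos_iff.2 (hne z hz1)
    have e1 : (L z).re = (1 - ‖w‖ ^ 2)⁻¹ * ((1 - ‖w‖ ^ 2 * ‖z‖ ^ 2) / ‖v‖ ^ 2) := by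
      simp only [hL]
      rw [← Complex.ofReal_inv, Complex.re_ofReal_mul]
      congr 1
      rw [Complex.sub_re, Complex.one_re, ← hv, eq_div_iff (by positivity)]
      have : (2 * v⁻¹).re * ‖v‖ ^ 2 = 2 * v.re := by
        rw [show (2 : ℂ) = ((2 : ℝ) : ℂ) by simp, Complex.re_ofReal_mul, Complex.inv_re,
          Complex.normSq_eq_norm_sq, mul_assoc, div_mul_cancel₀ _ (pow_ne_zero 2 hv0.ne')]
      rw [sub_mul, this, hv]
      simp only [← Complex.normSq_eq_norm_sq, Complex.normSq_apply, Complex.sub_re, Complex.sub_im,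
        Complex.mul_re, Complex.mul_im, Complex.conj_re, Complex.conj_im, Complex.one_re,
        Complex.one_im]
      ring
    rw [e1, norm_inv, inv_pow, ← one_div (‖v‖ ^ 2), ← div_eq_inv_mul, le_div_iff₀ hE,
      div_mul_eq_mul_div, one_mul]
    gcongr
    have : ‖z‖ ^ 2 ≤ 1 := by nlinarith [norm_nonneg z]
    exact mul_le_of_le_one_right (by positivity) this
  exact ⟨memHardy_of_circleAverage_le hk hbound, hardyNormSq_le hbound⟩

/-! ### Pairing `H(b)` with polynomials -/

/-- The Taylor coefficients at the origin. -/
noncomputable def taylorCoeff (f : ℂ → ℂ) (n : ℕ) : ℂ := (n.factorial : ℂ)⁻¹ * iteratedDeriv n f 0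

theorem hasSum_taylorCoeff {f : ℂ → ℂ} (hf : DifferentiableOn ℂ f (Metric.ball 0 1)) {z : ℂ}
    (hz : ‖z‖ < 1) : HasSum (fun n => taylorCoeff f n * z ^ n) (f z) := by
  have h := Complex.hasSum_taylorSeries_on_ball hf (show z ∈ Metric.ball (0 : ℂ) 1 by simpa using hz)
  refine h.congr_fun fun n => ?_
  simp only [taylorCoeff, smul_eq_mul, sub_zero]
  ring

/-- On `|z| = r` one has `conj z = r² / z`, which turns the average into Cauchy's formula for a
Taylor coefficient. -/
theorem circleAverage_conj_pow_mul {f : ℂ → ℂ} (hf : DifferentiableOn ℂ f (Metric.ball 0 1)) {r : ℝ}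
    (hr0 : 0 < r) (hr1 : r < 1) (n : ℕ) :
    Real.circleAverage (fun z => (starRingEnd ℂ) z ^ n * f z) 0 r =
      (r : ℂ) ^ (2 * n) * taylorCoeff f n := by
  have hd : DiffContOnCl ℂ f (Metric.ball 0 r) := (hf.mono fun z hz => by
    have h := Metric.closure_ball_subset_closedBall hz
    rw [mem_closedBall_zero_iff] at h
    rw [mem_ball_zero_iff]
    exact h.trans_lt hr1).diffContOnCl
  have hcongr : Set.EqOn (fun z => (z - 0)⁻¹ • ((starRingEnd ℂ) z ^ n * f z))
      (fun z => ((r : ℂ) ^ (2 * n)) • ((1 / (z - 0) ^ (n + 1)) • f z)) (Metric.sphere 0 r) := by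
    intro z hz
    rw [mem_sphere_zero_iff_norm] at hz
    have hz0 : z ≠ 0 := fun h => by simp [h] at hz; exact hr0.ne hz
    have hc : (starRingEnd ℂ) z = (r : ℂ) ^ 2 / z := by
      rw [eq_div_iff hz0, ← Complex.normSq_eq_conj_mul_self, Complex.normSq_eq_norm_sq, hz]
      norm_cast
    simp only [smul_eq_mul, sub_zero, hc]
    rw [div_pow, ← pow_mul, pow_succ]
    field_simp
  rw [Real.circleAverage_eq_circleIntegral hr0.ne', circleIntegral.integral_congr hr0.le hcongr,
    circleIntegral.integral_smul, hd.circleIntegral_one_div_sub_center_pow_smul hr0]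
  simp only [smul_eq_mul, taylorCoeff]
  have : (Real.pi : ℂ) ≠ 0 := by exact_mod_cast Real.pi_ne_zero
  have := Complex.I_ne_zero
  field_simp

theorem circleAverage_conj_polynomial_mul {f : ℂ → ℂ}
    (hf : DifferentiableOn ℂ f (Metric.ball 0 1)) {r : ℝ} (hr0 : 0 < r) (hr1 : r < 1)
    (Q : Polynomial ℂ) :
    Real.circleAverage (fun z => (starRingEnd ℂ) (Q.eval z) * f z) 0 r =
      ∑ n ∈ Q.support, (starRingEnd ℂ) (Q.coeff n) * taylorCoeff f n * (r : ℂ) ^ (2 * n) := by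
  have hr : r ∈ Set.Ico (0 : ℝ) 1 := ⟨hr0.le, hr1⟩
  have h1 : (fun z => (starRingEnd ℂ) (Q.eval z) * f z) = fun z => ∑ n ∈ Q.support,
      (starRingEnd ℂ) (Q.coeff n) • ((starRingEnd ℂ) z ^ n * f z) := by
    ext z
    rw [Polynomial.eval_eq_sum, Polynomial.sum, map_sum, Finset.sum_mul]
    refine Finset.sum_congr rfl fun n _ => ?_
    rw [map_mul, map_pow, smul_eq_mul, mul_assoc]
  have hc : ∀ n : ℕ, CircleIntegrable (fun z => (starRingEnd ℂ) z ^ n * f z) 0 r := fun n =>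
    ((Complex.continuous_conj.continuousOn.pow n).mul
      (hf.continuousOn_sphere hr)).circleIntegrable_abs
  rw [h1, Real.circleAverage_fun_sum fun n _ => (hc n).const_fun_smul]
  refine Finset.sum_congr rfl fun n _ => ?_
  rw [Real.circleAverage_fun_smul, circleAverage_conj_pow_mul hf hr0 hr1, smul_eq_mul]
  ring

/-- Parseval on the unit circle for `Q (r X)`. -/
theorem circleAverage_norm_sq_polynomial (Q : Polynomial ℂ) (r : ℝ) :
    Real.circleAverage (fun z => ‖Q.eval z‖ ^ 2) 0 r =
      ∑ n ∈ Q.support, ‖Q.coeff n‖ ^ 2 * r ^ (2 * n) := by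
  have h1 := Polynomial.sum_sq_norm_coeff_eq_circleAverage
    (Q.comp (Polynomial.C (r : ℂ) * Polynomial.X))
  rw [Real.circleAverage_eq_circleAverage_zero_one]
  simp only [Polynomial.eval_comp, Polynomial.eval_mul, Polynomial.eval_C, Polynomial.eval_X,
    Polynomial.comp_C_mul_X_coeff] at h1
  simp only [add_zero]
  rw [← h1, ← Finset.sum_subset (s₁ := (Q.comp (Polynomial.C (r : ℂ) * Polynomial.X)).support)
    (s₂ := Q.support)]
  · refine Finset.sum_congr rfl fun n _ => ?_
    rw [norm_mul, mul_pow, norm_pow, Complex.norm_real, ← pow_mul, mul_comm n, pow_mul ‖r‖,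
      Real.norm_eq_abs, sq_abs, pow_mul]
  · intro n hn
    rw [Polynomial.mem_support_iff, Polynomial.comp_C_mul_X_coeff] at hn
    exact Polynomial.mem_support_iff.2 (left_ne_zero_of_mul hn)
  · intro n _ hn
    rw [Polynomial.mem_support_iff, Polynomial.comp_C_mul_X_coeff, not_not] at hn
    have h2 : ‖Q.coeff n‖ * |r| ^ n = 0 := by
      rw [← Real.norm_eq_abs, ← Complex.norm_real, ← norm_pow, ← norm_mul, hn, norm_zero]
    rw [pow_mul, ← sq_abs r, ← pow_mul, mul_comm 2, pow_mul, ← mul_pow, h2]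
    simp

open Filter Topology in
/-- The elements of `H(b)`, `b = B / D`, define functionals on polynomials which are dominated by
the `H²` norm after multiplication by the numerator of the mate. -/
theorem norm_sum_conj_mul_taylorCoeff_le {A B D : Polynomial ℂ} {b f : ℂ → ℂ}
    (hb : DifferentiableOn ℂ b (Metric.ball 0 1)) (hb1 : ∀ z : ℂ, ‖z‖ < 1 → ‖b z‖ ≤ 1)
    (hbD : ∀ z : ℂ, ‖z‖ < 1 → b z * D.eval z = B.eval z)
    (hABD : ∀ z : ℂ, ‖z‖ = 1 → ‖A.eval z‖ ^ 2 + ‖B.eval z‖ ^ 2 = ‖D.eval z‖ ^ 2)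
    (hf : MemDeBranges b f) (G : Polynomial ℂ) :
    ‖∑ n ∈ (B * G).support, (starRingEnd ℂ) ((B * G).coeff n) * taylorCoeff f n‖ ≤
      deBrangesNorm b f * Real.sqrt (∑ n ∈ (A * G).support, ‖(A * G).coeff n‖ ^ 2) := by
  set X : Polynomial ℂ → ℂ := fun G =>
    ∑ n ∈ (B * G).support, (starRingEnd ℂ) ((B * G).coeff n) * taylorCoeff f n with hX
  set e : Polynomial ℂ → ℝ := fun Q => ∑ n ∈ Q.support, ‖Q.coeff n‖ ^ 2 with he
  have he1 : ∀ Q, e Q = Real.circleAverage (fun z => ‖Q.eval z‖ ^ 2) 0 1 := fun Q => by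
    rw [circleAverage_norm_sq_polynomial]
    simp [he]
  have hcont : ∀ Q : Polynomial ℂ, CircleIntegrable (fun z => ‖Q.eval z‖ ^ 2) 0 1 := fun Q =>
    (Continuous.continuousOn (by fun_prop)).circleIntegrable_abs
  have heABD : ∀ G, e (A * G) + e (B * G) = e (D * G) := fun G => by
    rw [he1, he1, he1, ← Real.circleAverage_fun_add (hcont _) (hcont _)]
    refine Real.circleAverage_congr_sphere fun z hz => ?_
    rw [mem_sphere_zero_iff_norm, abs_one] at hz
    simp only [Polynomial.eval_mul, norm_mul, mul_pow, ← hABD z hz]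
    ring
  set K := sSup (deBrangesDefects b f) with hK
  have main : ∀ G, 2 * (X G).re ≤ K + e (A * G) := by
    intro G
    -- The test function `g = D G` makes `b g = B G` a polynomial, and `heABD` then leaves only `e
    -- (A * G)` from the subtracted norm.
    have hDG : MemHardy fun z => (D * G).eval z := by
      refine memHardy_of_circleAverage_le (D * G).differentiable.differentiableOn
        (K := e (D * G)) fun r hr => ?_
      rw [circleAverage_norm_sq_polynomial]
      exact Finset.sum_le_sum fun n _ =>
        mul_le_of_le_one_right (by positivity) (pow_le_one₀ hr.1 hr.2.le)
    have hDGe : hardyNormSq (fun z => (D * G).eval z) ≤ e (D * G) := by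
      refine hardyNormSq_le fun r hr => ?_
      rw [circleAverage_norm_sq_polynomial]
      exact Finset.sum_le_sum fun n _ =>
        mul_le_of_le_one_right (by positivity) (pow_le_one₀ hr.1 hr.2.le)
    have hsup := le_csSup hf.2 ⟨_, hDG, rfl⟩
    have hfb : MemHardy fun z => f z + b z * (D * G).eval z :=
      hf.1.add (hDG.mul_of_norm_le_one hb hb1)
    have hr_le : ∀ᶠ r : ℝ in 𝓝[<] 1,
        2 * (∑ n ∈ (B * G).support, (starRingEnd ℂ) ((B * G).coeff n) * taylorCoeff f n *
          (r : ℂ) ^ (2 * n)).re + ∑ n ∈ (B * G).support, ‖(B * G).coeff n‖ ^ 2 * r ^ (2 * n) ≤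
        K + e (D * G) := by
      filter_upwards [Ioo_mem_nhdsLT (show (0 : ℝ) < 1 by norm_num)] with r hr0
      have hr : r ∈ Set.Ico (0 : ℝ) 1 := ⟨hr0.1.le, hr0.2⟩
      set L : ℂ → ℂ := fun z => (starRingEnd ℂ) ((B * G).eval z) * f z with hL
      have hLc : ContinuousOn L (Metric.sphere 0 |r|) :=
        (Complex.continuous_conj.comp (B * G).continuous).continuousOn.mul
          (hf.1.1.continuousOn_sphere hr)
      have hLi : CircleIntegrable (fun z => (2 : ℝ) • (L z).re) 0 r :=
        ((Complex.continuous_re.comp_continuousOn hLc).circleIntegrable_abs).const_fun_smul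
      have hBG : CircleIntegrable (fun z => ‖(B * G).eval z‖ ^ 2) 0 r :=
        (Continuous.continuousOn (by fun_prop)).circleIntegrable_abs
      rw [← circleAverage_norm_sq_polynomial,
        ← circleAverage_conj_polynomial_mul hf.1.1 hr0.1 hr0.2, ← circleAverage_re hLc,
        ← smul_eq_mul, ← Real.circleAverage_fun_smul, ← Real.circleAverage_fun_add hLi hBG]
      have h1 := circleAverage_norm_sq_le_hardyNormSq hfb hr
      refine le_trans (le_trans (Real.circleAverage_mono (hLi.add hBG)
        (hfb.1.circleIntegrable_norm_sq hr) fun z hz => ?_) h1) (by linarith)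
      have hz1 := norm_lt_one_of_mem_sphere hr hz
      simp only [smul_eq_mul, hL]
      have hbDG : b z * (D * G).eval z = (B * G).eval z := by
        rw [Polynomial.eval_mul, ← mul_assoc, hbD z hz1, ← Polynomial.eval_mul]
      rw [hbDG]
      simp only [← Complex.normSq_eq_norm_sq, Complex.normSq_apply, Complex.add_re, Complex.add_im,
        Complex.mul_re, Complex.conj_re, Complex.conj_im]
      -- The term `|f|²` of the expanded square is dropped.
      nlinarith [sq_nonneg (f z).re, sq_nonneg (f z).im]
    have hlim : Tendsto (fun r : ℝ =>
        2 * (∑ n ∈ (B * G).support, (starRingEnd ℂ) ((B * G).coeff n) * taylorCoeff f n *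
          (r : ℂ) ^ (2 * n)).re + ∑ n ∈ (B * G).support, ‖(B * G).coeff n‖ ^ 2 * r ^ (2 * n))
        (𝓝[<] 1) (𝓝 (2 * (X G).re + e (B * G))) := by
      have hc : Continuous fun r : ℝ =>
        2 * (∑ n ∈ (B * G).support, (starRingEnd ℂ) ((B * G).coeff n) * taylorCoeff f n *
          (r : ℂ) ^ (2 * n)).re + ∑ n ∈ (B * G).support, ‖(B * G).coeff n‖ ^ 2 * r ^ (2 * n) := by
        fun_prop
      have := (hc.tendsto 1).mono_left (nhdsWithin_le_nhds (s := Set.Iio 1))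
      simpa [hX, he] using this
    have h2 := le_of_tendsto hlim hr_le
    linarith [heABD G]
  have hXs : ∀ (τ : ℂ), X (Polynomial.C τ * G) = (starRingEnd ℂ) τ * X G := by
    intro τ
    by_cases hτ : τ = 0
    · simp [hτ, hX]
    · have hsupp : (B * (Polynomial.C τ * G)).support = (B * G).support := by
        ext n
        rw [mul_left_comm]
        simp [hτ]
      simp only [hX, hsupp]
      rw [Finset.mul_sum]
      refine Finset.sum_congr rfl fun n _ => ?_
      rw [mul_left_comm B, Polynomial.coeff_C_mul, map_mul, mul_assoc]
  have hes : ∀ (τ : ℂ), e (A * (Polynomial.C τ * G)) = ‖τ‖ ^ 2 * e (A * G) := by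
    intro τ
    rw [he1, he1, ← smul_eq_mul (a := ‖τ‖ ^ 2), ← Real.circleAverage_fun_smul]
    congr 1
    ext z
    simp only [Polynomial.eval_mul, Polynomial.eval_C, norm_mul, smul_eq_mul]
    ring
  -- `X` is conjugate-homogeneous, so scaling `G` by `s · X G` makes the linear term real. The
  -- discriminant then gives the Cauchy–Schwarz type bound.
  have hquad : ∀ s : ℝ, 0 ≤ ‖X G‖ ^ 2 * e (A * G) * (s * s) + (-2 * ‖X G‖ ^ 2) * s + K := by
    intro s
    have h1 := main (Polynomial.C (s * X G) * G)
    rw [hXs, hes, map_mul, Complex.conj_ofReal, mul_assoc, ← Complex.normSq_eq_conj_mul_self,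
      Complex.re_ofReal_mul, Complex.ofReal_re, Complex.normSq_eq_norm_sq, norm_mul,
      Complex.norm_real, Real.norm_eq_abs, mul_pow, sq_abs] at h1
    nlinarith
  have hdisc := discrim_le_zero hquad
  rw [discrim] at hdisc
  have he0 : 0 ≤ e (A * G) := Finset.sum_nonneg fun _ _ => by positivity
  have hK0 : 0 ≤ K := by simpa using hquad 0
  have hfin : ‖X G‖ ^ 2 ≤ K * e (A * G) := by
    by_cases hx : ‖X G‖ ^ 2 = 0
    · rw [hx]
      positivity
    · have hx' : 0 < ‖X G‖ ^ 2 := lt_of_le_of_ne (by positivity) (Ne.symm hx)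
      refine le_of_mul_le_mul_left ?_ hx'
      nlinarith
  change ‖X G‖ ≤ Real.sqrt K * Real.sqrt (e (A * G))
  rw [← Real.sqrt_mul hK0]
  exact Real.le_sqrt_of_sq_le hfin

/-- A functional on polynomials which is dominated by the `ℓ²` norm after multiplication by a fixed
polynomial is given by a functional on `ℓ²`. -/
theorem exists_coeff_of_norm_le {A : Polynomial ℂ} (hA : A ≠ 0) (Λ : Polynomial ℂ →ₗ[ℂ] ℂ) {K : ℝ}
    (hK : 0 ≤ K) (hΛ : ∀ G : Polynomial ℂ,
      ‖Λ G‖ ≤ K * Real.sqrt (∑ n ∈ (A * G).support, ‖(A * G).coeff n‖ ^ 2)) :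
    ∃ (M : Polynomial ℂ →ₗ[ℂ] ℂ), (∀ G, M (A * G) = Λ G) ∧
      ∀ z : ℂ, ‖z‖ < 1 → ∃ H : ℂ, HasSum (fun n => M (Polynomial.X ^ n) * z ^ n) H ∧
        ‖H‖ ≤ K / Real.sqrt (1 - ‖z‖ ^ 2) := by
  set E := lp (fun _ : ℕ => ℂ) 2 with hE
  set T : Polynomial ℂ →ₗ[ℂ] E := Polynomial.lsum fun n => lp.lsingle (𝕜 := ℂ) (E := fun _ : ℕ => ℂ) 2 n with hT
  have hTsum : ∀ Q : Polynomial ℂ, T Q = ∑ n ∈ Q.support, lp.single 2 n (Q.coeff n) := fun Q => rfl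
  have hTnorm : ∀ Q : Polynomial ℂ, ‖T Q‖ = Real.sqrt (∑ n ∈ Q.support, ‖Q.coeff n‖ ^ 2) := by
    intro Q
    have h := lp.norm_sum_single (E := fun _ : ℕ => ℂ) (p := 2) (by norm_num) Q.coeff Q.support
    rw [← hTsum] at h
    simp only [ENNReal.toReal_ofNat, Real.rpow_ofNat] at h
    rw [← h, Real.sqrt_sq (norm_nonneg _)]
  set U : Polynomial ℂ →ₗ[ℂ] E := T ∘ₗ LinearMap.mulLeft ℂ A with hU
  have hUa : ∀ G, U G = T (A * G) := fun G => rfl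
  have hUinj : Function.Injective U := by
    rw [← LinearMap.ker_eq_bot, LinearMap.ker_eq_bot']
    intro G hG
    have h1 : ‖T (A * G)‖ = 0 := by rw [← hUa, hG, norm_zero]
    rw [hTnorm, Real.sqrt_eq_zero (Finset.sum_nonneg fun _ _ => by positivity),
      Finset.sum_eq_zero_iff_of_nonneg fun _ _ => by positivity] at h1
    have h2 : A * G = 0 := by
      rw [← Polynomial.support_eq_empty, Finset.eq_empty_iff_forall_notMem]
      intro n hn
      have := h1 n hn
      simp only [ne_eq, OfNat.ofNat_ne_zero, not_false_eq_true, pow_eq_zero_iff,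
        norm_eq_zero] at this
      exact Polynomial.mem_support_iff.1 hn this
    exact (mul_eq_zero.1 h2).resolve_left hA
  -- As `A ≠ 0`, `G` is determined by `A G`, so `Λ` becomes a functional of norm at most `K` on the
  -- range of `U` in `ℓ²`; Hahn–Banach extends it.
  set ε := LinearEquiv.ofInjective U hUinj with hε
  set g₀ : LinearMap.range U →L[ℂ] ℂ := (Λ ∘ₗ ε.symm.toLinearMap).mkContinuous K (by
    intro x
    obtain ⟨G, rfl⟩ := ε.surjective x
    have h1 : ‖ε G‖ = ‖T (A * G)‖ := rfl
    rw [h1, hTnorm]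
    simpa using hΛ G) with hg₀
  obtain ⟨g, hg, hgn⟩ := exists_extension_norm_eq (𝕜 := ℂ) (LinearMap.range U) g₀
  have hgK : ‖g‖ ≤ K := hgn.le.trans (LinearMap.mkContinuous_norm_le _ hK _)
  refine ⟨g.toLinearMap ∘ₗ T, fun G => ?_, fun z hz => ?_⟩
  · have h1 := hg (ε G)
    have h2 : ((ε G : LinearMap.range U) : E) = T (A * G) := rfl
    rw [h2] at h1
    simpa [hg₀] using h1
  · have hs : HasSum (fun n : ℕ => (‖z‖ ^ 2) ^ n) (1 - ‖z‖ ^ 2)⁻¹ :=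
      hasSum_geometric_of_lt_one (by positivity) (by nlinarith [norm_nonneg z])
    have hs' : HasSum (fun n : ℕ => ‖z ^ n‖ ^ (2 : ENNReal).toReal) (1 - ‖z‖ ^ 2)⁻¹ := by
      refine hs.congr_fun fun n => ?_
      simp only [ENNReal.toReal_ofNat, Real.rpow_ofNat, norm_pow]
      rw [← pow_mul, ← pow_mul, mul_comm]
    -- The power series is the functional evaluated at the sequence `(z ^ n)`, whose `ℓ²` norm is
    -- `(1 - |z|²)^(-1/2)`.
    set k : E := ⟨fun n => z ^ n, memℓp_gen hs'.summable⟩ with hk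
    have hkn : ‖k‖ = (Real.sqrt (1 - ‖z‖ ^ 2))⁻¹ := by
      have h1 := lp.norm_rpow_eq_tsum (p := 2) (by norm_num) k
      have h2 : (∑' n : ℕ, ‖k n‖ ^ (2 : ENNReal).toReal) = (1 - ‖z‖ ^ 2)⁻¹ := hs'.tsum_eq
      rw [h2] at h1
      simp only [ENNReal.toReal_ofNat, Real.rpow_ofNat] at h1
      rw [← Real.sqrt_inv, ← h1, Real.sqrt_sq (norm_nonneg _)]
    refine ⟨g k, ?_, ?_⟩
    · have h1 := (lp.hasSum_single (E := fun _ : ℕ => ℂ) (p := 2) (by norm_num) k).mapL g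
      refine h1.congr_fun fun n => ?_
      have h2 : T (Polynomial.X ^ n) = lp.single 2 n (1 : ℂ) := by
        rw [Polynomial.X_pow_eq_monomial]
        simp [hT, Polynomial.lsum_apply, Polynomial.sum_monomial_index]
        rfl
      have h3 : lp.single (E := fun _ : ℕ => ℂ) 2 n (k n) =
          z ^ n • lp.single (E := fun _ : ℕ => ℂ) 2 n (1 : ℂ) := by
        rw [← lp.single_smul]
        simp [hk]
      rw [h3, map_smul, smul_eq_mul, LinearMap.comp_apply, h2, mul_comm]
      rfl
    · refine (g.le_opNorm k).trans ?_
      rw [hkn, div_eq_mul_inv]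
      gcongr

/-! ### Reflected polynomials and the expansion of elements of `H(b)` -/

/-- The polynomial `z^N conj (Q (1 / conj z))`. -/
noncomputable def conjReflect (N : ℕ) (Q : Polynomial ℂ) : Polynomial ℂ :=
  ∑ i ∈ Finset.range (N + 1), Polynomial.C ((starRingEnd ℂ) (Q.coeff i)) * Polynomial.X ^ (N - i)

theorem eval_conjReflect {N : ℕ} {Q : Polynomial ℂ} (hQ : Q.natDegree ≤ N) {z : ℂ} (hz : z ≠ 0) :
    (conjReflect N Q).eval z = z ^ N * (starRingEnd ℂ) (Q.eval ((starRingEnd ℂ) z)⁻¹) := by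
  rw [conjReflect, Polynomial.eval_finsetSum, Polynomial.eval_eq_sum_range' (Nat.lt_succ_of_le hQ),
    map_sum, Finset.mul_sum]
  refine Finset.sum_congr rfl fun i hi => ?_
  have hi' : i ≤ N := Nat.lt_succ_iff.1 (Finset.mem_range.1 hi)
  simp only [Polynomial.eval_mul, Polynomial.eval_C, Polynomial.eval_pow, Polynomial.eval_X,
    map_mul, map_pow, map_inv₀, Complex.conj_conj]
  rw [pow_sub₀ z hz hi', inv_pow]
  ring

/-- The terms of degree less than `N` in the product of `conjReflect N Q` with a power series. -/
noncomputable def conjReflectLow (N : ℕ) (Q : Polynomial ℂ) (c : ℕ → ℂ) : Polynomial ℂ :=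
  ∑ i ∈ Finset.range (N + 1), ∑ n ∈ Finset.range i,
    Polynomial.C ((starRingEnd ℂ) (Q.coeff i) * c n) * Polynomial.X ^ (N - i + n)

/-- The coefficient of degree `N + j` in the product is a backward-shift sum, the conjugate of a
functional evaluated at `Q X^j`. The identity between functionals thus determines `B* f - A* h` up
to its low-degree terms. -/
theorem hasSum_conjReflect_mul (N : ℕ) (Q : Polynomial ℂ) {c : ℕ → ℂ} {z F : ℂ}
    (h : HasSum (fun n => c n * z ^ n) F) :
    HasSum (fun j => (∑ i ∈ Finset.range (N + 1), (starRingEnd ℂ) (Q.coeff i) * c (j + i)) *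
      z ^ (N + j)) ((conjReflect N Q).eval z * F - (conjReflectLow N Q c).eval z) := by
  have h1 : ∀ i ∈ Finset.range (N + 1),
      HasSum (fun j => (starRingEnd ℂ) (Q.coeff i) * c (j + i) * z ^ (N + j))
        ((starRingEnd ℂ) (Q.coeff i) * z ^ (N - i) * F -
          ∑ n ∈ Finset.range i, (starRingEnd ℂ) (Q.coeff i) * c n * z ^ (N - i + n)) := by
    intro i hi
    have hi' : i ≤ N := Nat.lt_succ_iff.1 (Finset.mem_range.1 hi)
    have h2 := ((hasSum_nat_add_iff' i).2 h).mul_left ((starRingEnd ℂ) (Q.coeff i) * z ^ (N - i))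
    rw [mul_sub, Finset.mul_sum] at h2
    have e1 : ∑ n ∈ Finset.range i, (starRingEnd ℂ) (Q.coeff i) * c n * z ^ (N - i + n) =
        ∑ n ∈ Finset.range i, (starRingEnd ℂ) (Q.coeff i) * z ^ (N - i) * (c n * z ^ n) :=
      Finset.sum_congr rfl fun n _ => by rw [pow_add]; ring
    rw [e1]
    refine h2.congr_fun fun j => ?_
    rw [show N + j = (N - i) + (j + i) by omega, pow_add]
    ring
  have h3 := hasSum_sum h1
  rw [Finset.sum_sub_distrib, ← Finset.sum_mul] at h3
  convert h3 using 1
  · ext j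
    rw [Finset.sum_mul]
  · simp [conjReflect, conjReflectLow, Polynomial.eval_finsetSum]

theorem Polynomial.map_mul_X_pow_eq_sum (ℓ : Polynomial ℂ →ₗ[ℂ] ℂ) {Q : Polynomial ℂ} {N : ℕ}
    (hQ : Q.natDegree ≤ N) (j : ℕ) :
    ℓ (Q * Polynomial.X ^ j) =
      ∑ i ∈ Finset.range (N + 1), Q.coeff i * ℓ (Polynomial.X ^ (j + i)) := by
  conv_lhs => rw [Q.as_sum_range' (N + 1) (Nat.lt_succ_of_le hQ)]
  rw [Finset.sum_mul, map_sum]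
  refine Finset.sum_congr rfl fun i _ => ?_
  rw [← Polynomial.C_mul_X_pow_eq_monomial, mul_assoc, ← pow_add, add_comm i,
    ← Polynomial.smul_eq_C_mul, map_smul, smul_eq_mul]

theorem natDegree_conjReflectLow_le (N : ℕ) (Q : Polynomial ℂ) (c : ℕ → ℂ) :
    (conjReflectLow N Q c).natDegree ≤ N := by
  refine Polynomial.natDegree_sum_le_of_forall_le _ _ fun i hi => ?_
  refine Polynomial.natDegree_sum_le_of_forall_le _ _ fun n hn => ?_
  refine (Polynomial.natDegree_C_mul_X_pow_le _ _).trans ?_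
  have := Finset.mem_range.1 hi
  have := Finset.mem_range.1 hn
  omega

/-- For `b = B / D` rational with mate `a = A / D`, every `f ∈ H(b)` satisfies `B* f = A* h + P`
with `h` in the Hardy space and `P` a polynomial, where `Q* (z) = z^N conj (Q (1 / conj z))`. -/
theorem exists_polynomial_norm_sub_le {A B D : Polynomial ℂ} {b f : ℂ → ℂ}
    (hb : DifferentiableOn ℂ b (Metric.ball 0 1)) (hb1 : ∀ z : ℂ, ‖z‖ < 1 → ‖b z‖ ≤ 1)
    (hbD : ∀ z : ℂ, ‖z‖ < 1 → b z * D.eval z = B.eval z)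
    (hABD : ∀ z : ℂ, ‖z‖ = 1 → ‖A.eval z‖ ^ 2 + ‖B.eval z‖ ^ 2 = ‖D.eval z‖ ^ 2)
    (hA : A ≠ 0) {N : ℕ} (hAN : A.natDegree ≤ N) (hBN : B.natDegree ≤ N)
    (hf : MemDeBranges b f) :
    ∃ P : Polynomial ℂ, P.natDegree ≤ N ∧ ∀ z : ℂ, ‖z‖ < 1 →
      ‖(conjReflect N B).eval z * f z - P.eval z‖ ≤
        ‖(conjReflect N A).eval z‖ * (deBrangesNorm b f / Real.sqrt (1 - ‖z‖ ^ 2)) := by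
  set c := taylorCoeff f with hc
  set L : Polynomial ℂ →ₗ[ℂ] ℂ :=
    Polynomial.lsum fun n => (starRingEnd ℂ) (c n) • (LinearMap.id : ℂ →ₗ[ℂ] ℂ) with hL
  have hLsum : ∀ Q : Polynomial ℂ, L Q = ∑ n ∈ Q.support, (starRingEnd ℂ) (c n) * Q.coeff n :=
    fun Q => rfl
  have hLX : ∀ n, L (Polynomial.X ^ n) = (starRingEnd ℂ) (c n) := fun n => by
    rw [Polynomial.X_pow_eq_monomial]
    simp [hL, Polynomial.lsum_apply, Polynomial.sum_monomial_index]
  obtain ⟨M, hM, hMsum⟩ := exists_coeff_of_norm_le hA (L ∘ₗ LinearMap.mulLeft ℂ B)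
    (Real.sqrt_nonneg _ : 0 ≤ deBrangesNorm b f) fun G => by
      refine le_of_eq_of_le ?_ (norm_sum_conj_mul_taylorCoeff_le hb hb1 hbD hABD hf G)
      rw [← RCLike.norm_conj, LinearMap.comp_apply, LinearMap.mulLeft_apply, hLsum, map_sum]
      congr 1
      refine Finset.sum_congr rfl fun n _ => ?_
      rw [map_mul, Complex.conj_conj, mul_comm]
  set h : ℕ → ℂ := fun n => (starRingEnd ℂ) (M (Polynomial.X ^ n)) with hh
  -- The relation `M (A G) = L (B G)` for `G = X^j`, conjugated: the products `B* f` and `A* h`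
  -- agree in all degrees at least `N`.
  have hcoef : ∀ j, ∑ i ∈ Finset.range (N + 1), (starRingEnd ℂ) (B.coeff i) * c (j + i) =
      ∑ i ∈ Finset.range (N + 1), (starRingEnd ℂ) (A.coeff i) * h (j + i) := fun j => by
    have h1 := hM (Polynomial.X ^ j)
    rw [LinearMap.comp_apply, LinearMap.mulLeft_apply, Polynomial.map_mul_X_pow_eq_sum M hAN,
      Polynomial.map_mul_X_pow_eq_sum L hBN] at h1
    have h2 := congrArg (starRingEnd ℂ) h1
    simp only [map_sum, map_mul, hLX, Complex.conj_conj] at h2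
    exact h2.symm
  refine ⟨conjReflectLow N B c - conjReflectLow N A h, (Polynomial.natDegree_sub_le _ _).trans
    (max_le (natDegree_conjReflectLow_le _ _ _) (natDegree_conjReflectLow_le _ _ _)),
    fun z hz => ?_⟩
  obtain ⟨H, hHsum, hH⟩ := hMsum ((starRingEnd ℂ) z) (by rwa [RCLike.norm_conj])
  have hHsum' : HasSum (fun n => h n * z ^ n) ((starRingEnd ℂ) H) := by
    have := hHsum.map (starRingEnd ℂ) Complex.continuous_conj
    refine this.congr_fun fun n => ?_
    simp [hh]
  have e1 := hasSum_conjReflect_mul N B (hasSum_taylorCoeff hf.1.1 hz)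
  have e2 := hasSum_conjReflect_mul N A hHsum'
  simp only [← hc, hcoef] at e1
  have e3 := e1.unique e2
  have e4 : (conjReflect N B).eval z * f z - (conjReflectLow N B c - conjReflectLow N A h).eval z =
      (conjReflect N A).eval z * (starRingEnd ℂ) H := by
    rw [Polynomial.eval_sub]
    linear_combination e3
  rw [e4, norm_mul, RCLike.norm_conj]
  rw [RCLike.norm_conj] at hH
  exact mul_le_mul_of_nonneg_left hH (norm_nonneg _)

-- The reflection `z ↦ 1 / conj z` fixes `ζ` and multiplies the distance to `ζ` by `1 / |z|`, so the
-- order of vanishing survives.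
open Filter Topology in
theorem eventually_norm_conjReflect_le {ζ : ℂ} (hζ : ‖ζ‖ = 1) {A : Polynomial ℂ} {N m : ℕ}
    (hAN : A.natDegree ≤ N) (hdvd : (Polynomial.X - Polynomial.C ζ) ^ m ∣ A) :
    ∃ K : ℝ, 0 < K ∧ ∀ᶠ z in 𝓝 ζ, ‖(conjReflect N A).eval z‖ ≤ K * ‖z - ζ‖ ^ m := by
  obtain ⟨C, hC⟩ := hdvd
  have hζ0 : ζ ≠ 0 := fun h => by simp [h] at hζ
  set g : ℂ → ℝ := fun z => ‖z‖ ^ N * ((‖z‖ ^ m)⁻¹ * ‖C.eval ((starRingEnd ℂ) z)⁻¹‖) with hg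
  have hgc : ContinuousAt g ζ := by
    have h1 : ContinuousAt (fun z : ℂ => ((starRingEnd ℂ) z)⁻¹) ζ :=
      Complex.continuous_conj.continuousAt.inv₀ (by simpa using hζ0)
    have h2 : ContinuousAt (fun z : ℂ => ‖C.eval ((starRingEnd ℂ) z)⁻¹‖) ζ :=
      (C.continuous.continuousAt.comp h1).norm
    exact (continuous_norm.continuousAt.pow N).mul
      (((continuous_norm.continuousAt.pow m).inv₀ (by simp [hζ])).mul h2)
  have hg0 : 0 ≤ g ζ := by positivity
  refine ⟨g ζ + 1, by linarith, ?_⟩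
  filter_upwards [hgc.eventually (gt_mem_nhds (lt_add_one _)), isOpen_ne.mem_nhds hζ0]
    with z hz hz0
  have hz0 : z ≠ 0 := hz0
  have hconj : ‖((starRingEnd ℂ) z)⁻¹ - ζ‖ = ‖z - ζ‖ * ‖z‖⁻¹ := by
    have h1 : (starRingEnd ℂ) (((starRingEnd ℂ) z)⁻¹ - ζ) = z⁻¹ - ζ⁻¹ := by
      rw [map_sub, map_inv₀, Complex.conj_conj, Complex.inv_def ζ, Complex.normSq_eq_norm_sq, hζ]
      simp
    rw [← RCLike.norm_conj, h1, inv_sub_inv hz0 hζ0, norm_div, norm_mul, hζ, mul_one,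
      norm_sub_rev, div_eq_mul_inv]
  have e : ‖(conjReflect N A).eval z‖ = g z * ‖z - ζ‖ ^ m := by
    rw [eval_conjReflect hAN hz0, hC, norm_mul, RCLike.norm_conj, norm_pow, Polynomial.eval_mul,
      Polynomial.eval_pow, Polynomial.eval_sub, Polynomial.eval_X, Polynomial.eval_C, norm_mul,
      norm_pow, hconj, mul_pow, inv_pow]
    ring
  rw [e]
  exact mul_le_mul_of_nonneg_right hz.le (by positivity)

theorem eval_conjReflect_ne_zero {ζ : ℂ} (hζ : ‖ζ‖ = 1) {B : Polynomial ℂ} {N : ℕ}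
    (hBN : B.natDegree ≤ N) (hB : B.eval ζ ≠ 0) : (conjReflect N B).eval ζ ≠ 0 := by
  have hζ0 : ζ ≠ 0 := fun h => by simp [h] at hζ
  have h1 : ((starRingEnd ℂ) ζ)⁻¹ = ζ := by
    rw [Complex.inv_def, Complex.normSq_conj, Complex.normSq_eq_norm_sq, hζ]
    simp
  rw [eval_conjReflect hBN hζ0, h1]
  exact mul_ne_zero (pow_ne_zero _ hζ0) ((map_ne_zero _).2 hB)

/-! ### Size and boundary vanishing of polynomials -/

/-- A polynomial of bounded degree is controlled on the unit disc by its values on a smaller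
disc. -/
theorem exists_norm_eval_le_of_natDegree_le (N : ℕ) :
    ∃ C : ℝ, 0 < C ∧ ∀ (R : Polynomial ℂ) (κ : ℝ), R.natDegree ≤ N →
      (∀ x : ℂ, ‖x‖ ≤ 1 / 2 → ‖R.eval x‖ ≤ κ) → ∀ z : ℂ, ‖z‖ ≤ 1 → ‖R.eval z‖ ≤ C * κ := by
  set s := Finset.range (N + 1) with hs
  -- `N + 1` distinct nodes in the half disc, enough to interpolate degree at most `N`.
  set v : ℕ → ℂ := fun i => (i : ℂ) / (2 * (N + 1)) with hv
  have hN : (2 * ((N : ℂ) + 1)) ≠ 0 := by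
    have : (N : ℂ) + 1 ≠ 0 := by exact_mod_cast Nat.succ_ne_zero N
    exact mul_ne_zero two_ne_zero this
  have hvinj : Set.InjOn v s := fun i _ j _ hij => by
    simp only [hv] at hij
    rw [div_left_inj' hN] at hij
    exact_mod_cast hij
  have hvn : ∀ i ∈ s, ‖v i‖ ≤ 1 / 2 := fun i hi => by
    have h1 : (i : ℝ) ≤ N + 1 := by exact_mod_cast (Finset.mem_range.1 hi).le
    have h2 : ‖(N : ℂ) + 1‖ = N + 1 := by
      rw [← Nat.cast_succ, Complex.norm_natCast]
      push_cast
      ring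
    simp only [hv, norm_div, norm_mul, h2, Complex.norm_natCast, Complex.norm_ofNat]
    rw [div_le_div_iff₀ (by positivity) (by norm_num)]
    linarith
  have hbd : ∀ Q : Polynomial ℂ, ∃ C : ℝ, 0 ≤ C ∧ ∀ z : ℂ, ‖z‖ ≤ 1 → ‖Q.eval z‖ ≤ C := by
    intro Q
    obtain ⟨C, hC⟩ := (isCompact_closedBall (0 : ℂ) 1).exists_bound_of_continuousOn
      Q.continuous.continuousOn
    exact ⟨max C 0, le_max_right _ _, fun z hz =>
      (hC z (by simpa using hz)).trans (le_max_left _ _)⟩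
  choose c hc0 hc using fun i => hbd (Lagrange.basis s v i)
  refine ⟨∑ i ∈ s, c i + 1, by have := Finset.sum_nonneg fun i (_ : i ∈ s) => hc0 i; linarith,
    fun R κ hR hκ z hz => ?_⟩
  have hdeg : R.degree < s.card := by
    rw [hs, Finset.card_range]
    exact lt_of_le_of_lt Polynomial.degree_le_natDegree (by exact_mod_cast Nat.lt_succ_of_le hR)
  have hκ0 : 0 ≤ κ := (norm_nonneg _).trans (hκ 0 (by simp))
  rw [Lagrange.eq_interpolate hvinj hdeg, Lagrange.interpolate_apply, Polynomial.eval_finsetSum]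
  refine (norm_sum_le _ _).trans ?_
  rw [add_mul, Finset.sum_mul, one_mul]
  refine le_add_of_le_of_nonneg (Finset.sum_le_sum fun i hi => ?_) hκ0
  rw [Polynomial.eval_mul, Polynomial.eval_C, norm_mul, mul_comm]
  exact mul_le_mul (hc i z hz) (hκ _ (hvn i hi)) (norm_nonneg _) (hc0 i)

open Filter Topology in
theorem tendsto_ofReal_mul_nhdsLT (ζ : ℂ) : Tendsto (fun r : ℝ => (r : ℂ) * ζ) (𝓝[<] 1) (𝓝 ζ) := by
  have : Continuous fun r : ℝ => (r : ℂ) * ζ := by fun_prop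
  simpa using (this.tendsto 1).mono_left nhdsWithin_le_nhds

open Filter Topology in
theorem tendsto_one_sub_pow_div_sqrt {m : ℕ} (hm : 0 < m) :
    Tendsto (fun r : ℝ => (1 - r) ^ m / Real.sqrt (1 - r)) (𝓝[<] 1) (𝓝 0) := by
  obtain ⟨k, rfl⟩ := Nat.exists_eq_add_of_lt hm
  have hc : Continuous fun r : ℝ => (1 - r) ^ k * Real.sqrt (1 - r) := by fun_prop
  have h1 := (hc.tendsto 1).mono_left (nhdsWithin_le_nhds (s := Set.Iio 1))
  simp only [sub_self, Real.sqrt_zero, mul_zero] at h1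
  refine h1.congr' ?_
  filter_upwards [self_mem_nhdsWithin] with r hr
  have hr' : 0 < 1 - r := sub_pos.2 hr
  rw [eq_div_iff (Real.sqrt_pos.2 hr').ne', mul_assoc, Real.mul_self_sqrt hr'.le, zero_add, pow_succ]

open Filter Topology in
/-- A polynomial that is small along a radius at a boundary point vanishes there to the expected
order. -/
theorem pow_dvd_of_eventually_norm_le {ζ : ℂ} (hζ : ‖ζ‖ = 1) {P : Polynomial ℂ} {m : ℕ} {C : ℝ}
    (h : ∀ᶠ r : ℝ in 𝓝[<] 1, ‖P.eval (r * ζ)‖ ≤ C * ((1 - r) ^ m / Real.sqrt (1 - r))) :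
    (Polynomial.X - Polynomial.C ζ) ^ m ∣ P := by
  by_cases hP : P = 0
  · simp [hP]
  rw [← Polynomial.le_rootMultiplicity_iff hP]
  by_contra! hlt
  obtain ⟨Q, hQ, hQd⟩ := Polynomial.exists_eq_pow_rootMultiplicity_mul_and_not_dvd P hP ζ
  set v := P.rootMultiplicity ζ with hv
  obtain ⟨k, hk⟩ := Nat.exists_eq_add_of_lt hlt
  have hQζ : Q.eval ζ ≠ 0 := fun h0 => hQd (Polynomial.dvd_iff_isRoot.2 h0)
  have h1 : Tendsto (fun r : ℝ => Q.eval (r * ζ)) (𝓝[<] 1) (𝓝 (Q.eval ζ)) :=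
    (Q.continuous.tendsto ζ).comp (tendsto_ofReal_mul_nhdsLT ζ)
  -- The bound has order `m - 1/2`, and a multiplicity `v < m` is at most `m - 1`, so half a power
  -- is left over and tends to `0`.
  have h2 : Tendsto (fun r : ℝ => Q.eval (r * ζ)) (𝓝[<] 1) (𝓝 0) := by
    have h3 := (tendsto_one_sub_pow_div_sqrt (Nat.succ_pos k)).const_mul C
    rw [mul_zero] at h3
    refine squeeze_zero_norm' ?_ h3
    filter_upwards [h, norm_ofReal_mul_eventually hζ] with r hr ⟨_, hr1, _, hr2⟩
    have ht : 0 < 1 - r := sub_pos.2 hr1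
    rw [hQ, Polynomial.eval_mul, Polynomial.eval_pow, Polynomial.eval_sub, Polynomial.eval_X,
      Polynomial.eval_C, norm_mul, norm_pow, hr2, hk, add_assoc, pow_add] at hr
    refine le_of_mul_le_mul_left (hr.trans_eq ?_) (pow_pos ht v)
    rw [Nat.succ_eq_add_one]
    ring
  exact hQζ (tendsto_nhds_unique h1 h2)

/-! ### Oscillation and the radial growth estimate -/

open Filter Topology in
/-- The bounded function `ψ ^ i` spins infinitely often as `ψ → 0` in the right half-plane. -/
theorem not_tendsto_exp_I_mul_log {ψ : ℝ → ℂ} (hc : ContinuousOn ψ (Set.Ioo 0 1))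
    (hre : ∀ r ∈ Set.Ioo (0 : ℝ) 1, 0 < (ψ r).re) (h0 : Tendsto ψ (𝓝[<] 1) (𝓝 0)) (L : ℂ) :
    ¬ Tendsto (fun r => Complex.exp (Complex.I * Complex.log (ψ r))) (𝓝[<] 1) (𝓝 L) := by
  intro hL
  have hne : ∀ r ∈ Set.Ioo (0 : ℝ) 1, ψ r ≠ 0 := fun r hr h => by
    have := hre r hr
    simp [h] at this
  -- `δ` is a lower bound for `|ψ ^ i| = exp (-arg ψ)` on the right half-plane. Where `log |ψ|` is
  -- an even or odd multiple of `π`, the real part is at least `δ` or at most `-δ`, and the two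
  -- cannot both lie within `δ` of `L.re`.
  set δ := Real.exp (-(Real.pi / 2)) with hδ
  have hδ0 : 0 < δ := Real.exp_pos _
  obtain ⟨r₀, hr₀, hsub⟩ := (mem_nhdsLT_iff_exists_Ioo_subset' (show (0 : ℝ) < 1 by norm_num)).1
    (inter_mem (Metric.tendsto_nhds.1 hL δ hδ0)
      (Ioo_mem_nhdsLT (show (0 : ℝ) < 1 by norm_num)))
  have hIoo : Set.Ioo r₀ 1 ⊆ Set.Ioo 0 1 := fun r hr => (hsub hr).2
  set a := (r₀ + 1) / 2 with ha
  have ha_mem : a ∈ Set.Ioo r₀ 1 := ⟨by linarith [Set.mem_Iio.1 hr₀], by linarith [Set.mem_Iio.1 hr₀]⟩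
  have hcont : ContinuousOn (fun r => Real.log ‖ψ r‖) (Set.Ioo r₀ 1) :=
    (hc.mono hIoo).norm.log fun r hr => norm_ne_zero_iff.2 (hne r (hIoo hr))
  have hbot : Tendsto (fun r => Real.log ‖ψ r‖) (𝓝[<] 1) atBot := by
    refine Real.tendsto_log_nhdsNE_zero.comp (tendsto_nhdsWithin_iff.2 ⟨by simpa using h0.norm, ?_⟩)
    filter_upwards [Ioo_mem_nhdsLT (show (0 : ℝ) < 1 by norm_num)] with r hr
    simpa using hne r hr
  have himg : Set.Iic (Real.log ‖ψ a‖) ⊆ (fun r => Real.log ‖ψ r‖) '' Set.Ioo r₀ 1 :=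
    isPreconnected_Ioo.intermediate_value_Iic ha_mem
      (le_principal_iff.2 (Ioo_mem_nhdsLT hr₀)) hcont hbot
  obtain ⟨n, hn⟩ := exists_nat_ge (-Real.log ‖ψ a‖)
  have hpi : 1 ≤ Real.pi := by linarith [Real.pi_gt_three]
  have hnp : (n : ℝ) ≤ n * (2 * Real.pi) := le_mul_of_one_le_right (Nat.cast_nonneg n) (by linarith)
  obtain ⟨r₁, hr₁, e₁⟩ := himg (show -(n * (2 * Real.pi)) ∈ Set.Iic (Real.log ‖ψ a‖) by
    rw [Set.mem_Iic]; linarith)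
  obtain ⟨r₂, hr₂, e₂⟩ := himg (show -(n * (2 * Real.pi) + Real.pi) ∈ Set.Iic (Real.log ‖ψ a‖) by
    rw [Set.mem_Iic]; linarith)
  have hval : ∀ r ∈ Set.Ioo r₀ 1, δ ≤ Real.exp (-(ψ r).arg) ∧
      (Complex.exp (Complex.I * Complex.log (ψ r))).re =
        Real.exp (-(ψ r).arg) * Real.cos (Real.log ‖ψ r‖) := by
    intro r hr
    have harg := Complex.abs_arg_lt_pi_div_two_iff.2 (Or.inl (hre r (hIoo hr)))
    refine ⟨Real.exp_le_exp.2 (by linarith [(abs_lt.1 harg).2]), ?_⟩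
    rw [Complex.exp_re]
    simp [Complex.log_re, Complex.log_im]
  have hdist : ∀ r ∈ Set.Ioo r₀ 1,
      |(Complex.exp (Complex.I * Complex.log (ψ r))).re - L.re| < δ := fun r hr => by
    rw [← Complex.sub_re]
    exact (Complex.abs_re_le_norm _).trans_lt (by simpa [dist_eq_norm] using (hsub hr).1)
  have k₁ := hdist r₁ hr₁
  have k₂ := hdist r₂ hr₂
  simp only at e₁ e₂
  rw [(hval r₁ hr₁).2, e₁, Real.cos_neg, Real.cos_nat_mul_two_pi, mul_one] at k₁
  rw [(hval r₂ hr₂).2, e₂, Real.cos_neg, Real.cos_nat_mul_two_pi_add_pi] at k₂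
  have := (abs_lt.1 k₁).2
  have := (abs_lt.1 k₂).1
  linarith [(hval r₁ hr₁).1, (hval r₂ hr₂).1]

set_option maxHeartbeats 1000000 in
open Filter Topology in
/-- The radial growth estimate for the symbols of a bounded weighted composition operator. -/
theorem exists_eventually_norm_sq_mul_le {a b u φ : ℂ → ℂ}
    (ha : DifferentiableOn ℂ a (Metric.ball 0 1)) (hb : DifferentiableOn ℂ b (Metric.ball 0 1))
    (hab : ∀ z : ℂ, ‖z‖ < 1 → ‖a z‖ ^ 2 + ‖b z‖ ^ 2 ≤ 1)
    (hφ : DifferentiableOn ℂ φ (Metric.ball 0 1))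
    (hmaps : Set.MapsTo φ (Metric.ball 0 1) (Metric.ball 0 1))
    (hW : IsBoundedWeightedComposition b u φ) {ζ η : ℂ} (hζ : ‖ζ‖ = 1) (hη : ‖η‖ = 1)
    (hlim : Tendsto (fun r : ℝ => φ (r * ζ)) (𝓝[<] 1) (𝓝 η)) {α β : Polynomial ℂ}
    {N m M : ℕ} (hm : 0 < m) (hM : 0 < M) (hβ : β.eval ζ ≠ 0) {K : ℝ} (hK : 0 < K)
    (hα : ∀ᶠ z in 𝓝 ζ, ‖α.eval z‖ ≤ K * ‖z - ζ‖ ^ m)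
    (hexp : ∀ f : ℂ → ℂ, MemDeBranges b f → ∃ P : Polynomial ℂ, P.natDegree ≤ N ∧
      ∀ z : ℂ, ‖z‖ < 1 → ‖β.eval z * f z - P.eval z‖ ≤
        ‖α.eval z‖ * (deBrangesNorm b f / Real.sqrt (1 - ‖z‖ ^ 2)))
    {κ : ℝ} (hκ : 0 < κ) (haη : ∀ᶠ w in 𝓝 η, κ * ‖w - η‖ ^ M ≤ ‖a w‖) :
    ∃ C : ℝ, ∀ᶠ r : ℝ in 𝓝[<] 1,
      ‖u (r * ζ)‖ ^ 2 * (1 - ‖φ (r * ζ)‖) ^ (2 * M - 1) ≤ C * (1 - r) ^ (2 * m - 1) := by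
  obtain ⟨C₀, hC₀⟩ := hW
  have hmaps' : ∀ {x : ℂ}, ‖x‖ < 1 → ‖φ x‖ < 1 := fun {x} hx => by
    simpa using hmaps (show x ∈ Metric.ball (0 : ℂ) 1 by simpa using hx)
  -- `t r = (1 - r)^(m - 1/2)` is the radial size of the error term in `hexp`.
  set t : ℝ → ℝ := fun r => (1 - r) ^ m / Real.sqrt (1 - r) with ht
  have hrad : ∀ᶠ r : ℝ in 𝓝[<] 1, 0 < r ∧ r < 1 ∧ ‖(r : ℂ) * ζ‖ = r ∧
      ‖(r : ℂ) * ζ - ζ‖ = 1 - r ∧ ∀ (f : ℂ → ℂ) (P : Polynomial ℂ),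
      (∀ z : ℂ, ‖z‖ < 1 → ‖β.eval z * f z - P.eval z‖ ≤
        ‖α.eval z‖ * (deBrangesNorm b f / Real.sqrt (1 - ‖z‖ ^ 2))) →
      ‖β.eval (r * ζ) * f (r * ζ) - P.eval (r * ζ)‖ ≤ K * deBrangesNorm b f * t r := by
    filter_upwards [norm_ofReal_mul_eventually hζ, (tendsto_ofReal_mul_nhdsLT ζ).eventually hα]
      with r ⟨hr0, hr1, hr2, hr3⟩ hr4
    refine ⟨hr0, hr1, hr2, hr3, fun f P hP => ?_⟩
    have h1 := hP (r * ζ) (by rw [hr2]; exact hr1)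
    rw [hr3] at hr4
    rw [hr2] at h1
    have h2 : 0 < 1 - r := sub_pos.2 hr1
    have h3 : Real.sqrt (1 - r) ≤ Real.sqrt (1 - r ^ 2) := Real.sqrt_le_sqrt (by nlinarith)
    have h4 := Real.sqrt_pos.2 h2
    have h5 : 0 ≤ deBrangesNorm b f := Real.sqrt_nonneg _
    calc _ ≤ _ := h1
      _ ≤ K * (1 - r) ^ m * (deBrangesNorm b f / Real.sqrt (1 - r)) := by gcongr
      _ = _ := by rw [ht]; ring
  have ht0 : ∀ r : ℝ, r < 1 → 0 < t r := fun r hr =>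
    div_pos (pow_pos (sub_pos.2 hr) m) (Real.sqrt_pos.2 (sub_pos.2 hr))
  have htpow : ∀ r : ℝ, 0 < r → r < 1 → (1 - r) ^ m ≤ t r := fun r hr0 hr => by
    rw [ht, le_div_iff₀ (Real.sqrt_pos.2 (sub_pos.2 hr))]
    refine mul_le_of_le_one_right (pow_nonneg (sub_pos.2 hr).le m) ?_
    exact Real.sqrt_le_iff.2 ⟨zero_le_one, by linarith⟩
  obtain ⟨Kβ, hKβ⟩ := (isCompact_closedBall (0 : ℂ) 1).exists_bound_of_continuousOn
    β.continuous.continuousOn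
  obtain ⟨Kα, hKα⟩ := (isCompact_closedBall (0 : ℂ) 1).exists_bound_of_continuousOn
    α.continuous.continuousOn
  have hone : MemHardy fun _ => (1 : ℂ) :=
    memHardy_of_norm_le (K := 1) (differentiableOn_const 1) (by simp)
  have hF := (hC₀ _ (memDeBranges_mul ha hb hab hone).1).1
  simp only [mul_one] at hF
  set F : ℂ → ℂ := fun z => u z * a (φ z) with hFdef
  obtain ⟨P, -, hP⟩ := hexp F hF
  -- Oscillation argument: if `P` vanishes only to order `v < m`, comparison of the expansions of
  -- `F` and `F · (q ∘ φ)` makes `q (φ (r ζ))` converge to `Q'(ζ) / Q(ζ)`.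
  have hdvd : (Polynomial.X - Polynomial.C ζ) ^ m ∣ P := by
    by_contra hnd
    have hP0 : P ≠ 0 := fun h => hnd (by simp [h])
    obtain ⟨Q, hQ, hQd⟩ := Polynomial.exists_eq_pow_rootMultiplicity_mul_and_not_dvd P hP0 ζ
    rw [← Polynomial.le_rootMultiplicity_iff hP0, not_le] at hnd
    set v := P.rootMultiplicity ζ with hv
    obtain ⟨k, hk⟩ := Nat.exists_eq_add_of_lt hnd
    have hQζ : Q.eval ζ ≠ 0 := fun h0 => hQd (Polynomial.dvd_iff_isRoot.2 h0)
    set ψ : ℂ → ℂ := fun w => 1 - (starRingEnd ℂ) η * w with hψ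
    have hψre : ∀ w : ℂ, ‖w‖ < 1 → 0 < (ψ w).re := fun w hw => by
      have h1 := Complex.re_le_norm ((starRingEnd ℂ) η * w)
      rw [norm_mul, RCLike.norm_conj, hη, one_mul] at h1
      simp only [hψ, Complex.sub_re, Complex.one_re]
      linarith
    set q : ℂ → ℂ := fun w => Complex.exp (Complex.I * Complex.log (ψ w)) with hq
    have hqn : ∀ w : ℂ, ‖w‖ < 1 → ‖q w‖ ≤ Real.exp Real.pi := fun w _ => by
      simp only [hq, Complex.norm_exp]
      refine Real.exp_le_exp.2 ?_
      simp only [Complex.mul_re, Complex.I_re, Complex.I_im, Complex.log_im]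
      linarith [Complex.neg_pi_lt_arg (ψ w)]
    have hqd : DifferentiableOn ℂ q (Metric.ball 0 1) := by
      refine ((DifferentiableOn.clog ?_ fun w hw => Or.inl (hψre w (by simpa using hw))).const_mul
        _).cexp
      exact (differentiableOn_const 1).sub (differentiableOn_id.const_mul _)
    have hqH : MemHardy q := memHardy_of_norm_le hqd hqn
    have hFq := (hC₀ _ (memDeBranges_mul ha hb hab hqH).1).1
    obtain ⟨P', -, hP'⟩ := hexp _ hFq
    have key : ∀ᶠ r : ℝ in 𝓝[<] 1,
        ‖q (φ (r * ζ)) * P.eval (r * ζ) - P'.eval (r * ζ)‖ ≤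
          (Real.exp Real.pi * (K * deBrangesNorm b F) +
            K * deBrangesNorm b fun z => u z * (a (φ z) * q (φ z))) * t r := by
      filter_upwards [hrad] with r ⟨_, hr1, hr2, _, hr4⟩
      have h1 := hr4 _ P hP
      have h2 := hr4 _ P' hP'
      have h3 := hqn (φ (r * ζ)) (hmaps' (by rw [hr2]; exact hr1))
      have e : q (φ (r * ζ)) * P.eval (r * ζ) - P'.eval (r * ζ) =
          -(q (φ (r * ζ)) * (β.eval (r * ζ) * F (r * ζ) - P.eval (r * ζ))) +
          (β.eval (r * ζ) * (u (r * ζ) * (a (φ (r * ζ)) * q (φ (r * ζ)))) - P'.eval (r * ζ)) := by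
        simp only [hFdef]
        ring
      rw [e]
      refine (norm_add_le _ _).trans ?_
      rw [norm_neg, norm_mul, add_mul]
      refine add_le_add ?_ h2
      calc _ ≤ Real.exp Real.pi * (K * deBrangesNorm b F * t r) :=
            mul_le_mul h3 h1 (norm_nonneg _) (Real.exp_pos _).le
        _ = _ := by ring
    set E := Real.exp Real.pi * (K * deBrangesNorm b F) +
            K * deBrangesNorm b fun z => u z * (a (φ z) * q (φ z)) with hE
    have hE0 : 0 ≤ E := by
      have hn : ∀ f, 0 ≤ deBrangesNorm b f := fun f => Real.sqrt_nonneg _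
      have := hn F
      have := hn fun z => u z * (a (φ z) * q (φ z))
      positivity
    obtain ⟨KQ, hKQ⟩ := (isCompact_closedBall (0 : ℂ) 1).exists_bound_of_continuousOn
      Q.continuous.continuousOn
    have htk : ∀ r : ℝ, t r = (1 - r) ^ v * ((1 - r) ^ (k + 1) / Real.sqrt (1 - r)) := fun r => by
      simp only [ht]
      rw [hk, add_assoc, pow_add]
      ring
    -- Since `q` is bounded, `P'` inherits the order `v` from `P`; half a power is given away to fit
    -- `pow_dvd_of_eventually_norm_le`.
    have hdvd' : (Polynomial.X - Polynomial.C ζ) ^ v ∣ P' := by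
      refine pow_dvd_of_eventually_norm_le hζ (C := Real.exp Real.pi * KQ + E) ?_
      filter_upwards [hrad, key] with r ⟨hr0, hr1, hr2, hr3, _⟩ hkey
      have h3 := hqn (φ (r * ζ)) (hmaps' (by rw [hr2]; exact hr1))
      have hr' : 0 < 1 - r := sub_pos.2 hr1
      have hs1 : Real.sqrt (1 - r) ≤ 1 := Real.sqrt_le_iff.2 ⟨zero_le_one, by linarith⟩
      have hs0 := Real.sqrt_pos.2 hr'
      have hKQr := hKQ (r * ζ) (by rw [mem_closedBall_zero_iff, hr2]; exact hr1.le)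
      have hKQ0 : 0 ≤ KQ := (norm_nonneg _).trans hKQr
      have hPn : ‖P.eval (r * ζ)‖ ≤ (1 - r) ^ v * KQ := by
        rw [hQ, Polynomial.eval_mul, Polynomial.eval_pow, Polynomial.eval_sub, Polynomial.eval_X,
          Polynomial.eval_C, norm_mul, norm_pow, hr3]
        gcongr
      have h5 : (1 - r) ^ v ≤ (1 - r) ^ v / Real.sqrt (1 - r) := by
        rw [le_div_iff₀ hs0]
        exact mul_le_of_le_one_right (by positivity) hs1
      have h6 : t r ≤ (1 - r) ^ v / Real.sqrt (1 - r) := by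
        simp only [ht]
        gcongr ?_ / _
        exact pow_le_pow_of_le_one hr'.le (by linarith) hnd.le
      have h7 : ‖P'.eval (r * ζ)‖ ≤ ‖q (φ (r * ζ)) * P.eval (r * ζ)‖ + E * t r := by
        have h8 := norm_sub_norm_le (P'.eval (r * ζ)) (q (φ (r * ζ)) * P.eval (r * ζ))
        rw [norm_sub_rev] at h8
        linarith
      rw [norm_mul] at h7
      calc _ ≤ _ := h7
        _ ≤ Real.exp Real.pi * ((1 - r) ^ v / Real.sqrt (1 - r) * KQ) +
            E * ((1 - r) ^ v / Real.sqrt (1 - r)) := by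
          gcongr
          exact hPn.trans (by gcongr)
        _ = _ := by ring
    obtain ⟨Q', hQ'⟩ := hdvd'
    have hdiff : Tendsto (fun r : ℝ => q (φ (r * ζ)) * Q.eval (r * ζ) - Q'.eval (r * ζ))
        (𝓝[<] 1) (𝓝 0) := by
      have h3 := (tendsto_one_sub_pow_div_sqrt (Nat.succ_pos k)).const_mul E
      rw [mul_zero] at h3
      refine squeeze_zero_norm' ?_ h3
      filter_upwards [hrad, key] with r ⟨_, hr1, _, hr3, _⟩ hkey
      have hr' : 0 < 1 - r := sub_pos.2 hr1
      refine le_of_mul_le_mul_left ?_ (pow_pos hr' v)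
      rw [htk] at hkey
      rw [Nat.succ_eq_add_one]
      calc (1 - r) ^ v * ‖q (φ (r * ζ)) * Q.eval (r * ζ) - Q'.eval (r * ζ)‖
          = ‖q (φ (r * ζ)) * P.eval (r * ζ) - P'.eval (r * ζ)‖ := by
            rw [hQ, hQ', Polynomial.eval_mul, Polynomial.eval_mul, Polynomial.eval_pow,
              Polynomial.eval_sub, Polynomial.eval_X, Polynomial.eval_C, ← hr3, ← norm_pow,
              ← norm_mul]
            congr 1
            ring
        _ ≤ _ := hkey
        _ = _ := by ring
    have hQlim : Tendsto (fun r : ℝ => Q.eval (r * ζ)) (𝓝[<] 1) (𝓝 (Q.eval ζ)) :=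
      (Q.continuous.tendsto ζ).comp (tendsto_ofReal_mul_nhdsLT ζ)
    have hQ'lim : Tendsto (fun r : ℝ => Q'.eval (r * ζ)) (𝓝[<] 1) (𝓝 (Q'.eval ζ)) :=
      (Q'.continuous.tendsto ζ).comp (tendsto_ofReal_mul_nhdsLT ζ)
    have hqlim := (hdiff.add hQ'lim).div hQlim hQζ
    refine not_tendsto_exp_I_mul_log (ψ := fun r : ℝ => ψ (φ (r * ζ))) ?_ ?_ ?_ _
      (hqlim.congr' ?_)
    · have h1 : ContinuousOn (fun r : ℝ => φ (r * ζ)) (Set.Ioo 0 1) := by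
        refine hφ.continuousOn.comp (by fun_prop) fun r hr => ?_
        rw [mem_ball_zero_iff, norm_mul, hζ, mul_one, Complex.norm_real,
          Real.norm_of_nonneg hr.1.le]
        exact hr.2
      exact continuousOn_const.sub (continuousOn_const.mul h1)
    · intro r hr
      refine hψre _ (hmaps' ?_)
      rw [norm_mul, hζ, mul_one, Complex.norm_real, Real.norm_of_nonneg hr.1.le]
      exact hr.2
    · have h1 := (hlim.const_mul ((starRingEnd ℂ) η)).const_sub 1
      rw [← Complex.normSq_eq_conj_mul_self, Complex.normSq_eq_norm_sq, hη] at h1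
      simpa using h1
    · filter_upwards [hQlim.eventually_ne hQζ] with r hr
      simp only [Pi.div_apply, hq]
      field_simp
      ring
  obtain ⟨C₁, hC₁0, hC₁⟩ := exists_norm_eval_le_of_natDegree_le N
  have hcpt := isCompact_closedBall (0 : ℂ) (1 / 2)
  have hsubball : Metric.closedBall (0 : ℂ) (1 / 2) ⊆ Metric.ball 0 1 :=
    Metric.closedBall_subset_ball (by norm_num)
  obtain ⟨KF, hKF⟩ := hcpt.exists_bound_of_continuousOn (hF.1.1.continuousOn.mono hsubball)
  obtain ⟨Kφ, hKφ⟩ := hcpt.exists_bound_of_continuousOn (f := fun z => ((1 - ‖φ z‖ : ℝ))⁻¹)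
    ((continuousOn_const.sub (hφ.continuousOn.mono hsubball).norm).inv₀ fun z hz =>
      (sub_pos.2 (hmaps' (by simpa using hsubball hz))).ne')
  have hKF0 : 0 ≤ KF := (norm_nonneg _).trans (hKF 0 (by simp))
  have hKφ0 : 0 ≤ Kφ := (norm_nonneg _).trans (hKφ 0 (by simp))
  have hKβ0 : 0 ≤ Kβ := (norm_nonneg _).trans (hKβ 0 (by simp))
  have hKα0 : 0 ≤ Kα := (norm_nonneg _).trans (hKα 0 (by simp))
  -- Bound, up to the factor `s`, for the quotient `Pw / (X - ζ)^m` on `|x| ≤ 1/2`: there `|x - ζ| ≥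
  -- 1/2` gives `2 ^ m`, and `√(1 - |x|²) ≥ 1/2` gives `2 |C₀|`.
  set S : ℝ := 2 ^ m * (Kβ * (KF * Kφ) + Kα * (2 * |C₀|)) with hS
  have hS0 : 0 ≤ S := by positivity
  -- Uniformity in `w` is essential, because `w = φ (r ζ)` will move with `r`.
  have main : ∀ᶠ r : ℝ in 𝓝[<] 1, ∀ w : ℂ, ‖w‖ < 1 →
      ‖β.eval (r * ζ)‖ * (‖F (r * ζ)‖ * ‖(1 - (starRingEnd ℂ) w * φ (r * ζ))⁻¹‖) ≤
        (C₁ * S + K * |C₀|) * Real.sqrt (1 - ‖w‖ ^ 2)⁻¹ * t r := by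
    filter_upwards [hrad] with r ⟨hr0, hr1, hr2, hr3, hr4⟩ w hw
    obtain ⟨hkH, hkn⟩ := hardyNormSq_szego_le hw
    set s := Real.sqrt (1 - ‖w‖ ^ 2)⁻¹ with hs
    have hE : 0 < 1 - ‖w‖ ^ 2 := by nlinarith [norm_nonneg w]
    have hs1 : 1 ≤ s := by
      rw [hs, Real.one_le_sqrt]
      exact (one_le_inv₀ hE).2 (by nlinarith [sq_nonneg ‖w‖])
    obtain ⟨hk1, hk2⟩ := memDeBranges_mul ha hb hab hkH
    have hk3 := deBrangesNorm_le_of_forall_le fun t' ht' => (hk2 t' ht').trans hkn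
    obtain ⟨hf, hfn⟩ := hC₀ _ hk1
    set f : ℂ → ℂ := fun z => u z * (a (φ z) * (1 - (starRingEnd ℂ) w * φ z)⁻¹) with hfdef
    have hfF : ∀ z, f z = F z * (1 - (starRingEnd ℂ) w * φ z)⁻¹ := fun z => by
      simp only [hfdef, hFdef]
      ring
    have hfn' : deBrangesNorm b f ≤ |C₀| * s :=
      hfn.trans ((mul_le_mul_of_nonneg_right (le_abs_self _) (Real.sqrt_nonneg _)).trans
        (mul_le_mul_of_nonneg_left hk3 (abs_nonneg _)))
    obtain ⟨Pw, hPwdeg, hPw⟩ := hexp f hf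
    -- For fixed `w` the factor `1 / (1 - conj w φ)` is bounded, so `β f` is `O(t)` because `β F`
    -- is. The constant depends badly on `w`, but only divisibility is extracted.
    have hPwd : (Polynomial.X - Polynomial.C ζ) ^ m ∣ Pw := by
      obtain ⟨R, hR⟩ := hdvd
      obtain ⟨KR, hKR⟩ := (isCompact_closedBall (0 : ℂ) 1).exists_bound_of_continuousOn
        R.continuous.continuousOn
      refine pow_dvd_of_eventually_norm_le hζ
        (C := (KR + K * deBrangesNorm b F) * (1 - ‖w‖)⁻¹ + K * deBrangesNorm b f) ?_
      filter_upwards [hrad] with x ⟨hx0, hx1, hx2, hx3, hx4⟩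
      have hKRx := hKR (x * ζ) (by rw [mem_closedBall_zero_iff, hx2]; exact hx1.le)
      have hKR0 : 0 ≤ KR := (norm_nonneg _).trans hKRx
      have h1 := hx4 _ P hP
      have h2 := hx4 _ Pw hPw
      have hφx := hmaps' (x := x * ζ) (by rw [hx2]; exact hx1)
      have h3 : ‖(1 - (starRingEnd ℂ) w * φ (x * ζ))⁻¹‖ ≤ (1 - ‖w‖)⁻¹ := by
        rw [norm_inv]
        refine inv_anti₀ (sub_pos.2 hw) ?_
        have := norm_sub_norm_le (1 : ℂ) ((starRingEnd ℂ) w * φ (x * ζ))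
        rw [norm_one, norm_mul, RCLike.norm_conj] at this
        nlinarith [norm_nonneg w, norm_nonneg (φ (x * ζ))]
      have h4 : ‖P.eval (x * ζ)‖ ≤ KR * t x := by
        rw [hR, Polynomial.eval_mul, Polynomial.eval_pow, Polynomial.eval_sub, Polynomial.eval_X,
          Polynomial.eval_C, norm_mul, norm_pow, hx3, mul_comm]
        exact mul_le_mul hKRx (htpow x hx0 hx1) (pow_nonneg (sub_pos.2 hx1).le _) hKR0
      have h5 : ‖β.eval (x * ζ) * F (x * ζ)‖ ≤ (KR + K * deBrangesNorm b F) * t x := by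
        have := norm_sub_norm_le (β.eval (x * ζ) * F (x * ζ)) (P.eval (x * ζ))
        linarith
      have h6 : ‖β.eval (x * ζ) * f (x * ζ)‖ ≤
          (KR + K * deBrangesNorm b F) * t x * (1 - ‖w‖)⁻¹ := by
        rw [hfF, ← mul_assoc, norm_mul]
        exact mul_le_mul h5 h3 (norm_nonneg _) ((norm_nonneg _).trans h5)
      have h7 := norm_sub_norm_le (Pw.eval (x * ζ)) (β.eval (x * ζ) * f (x * ζ))
      rw [norm_sub_rev] at h7
      change _ ≤ _ * t x
      linarith
    obtain ⟨R, hR⟩ := hPwd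
    have hRdeg : R.natDegree ≤ N := by
      refine le_trans ?_ hPwdeg
      by_cases hR0 : R = 0
      · simp [hR0]
      · rw [hR]
        rw [Polynomial.natDegree_mul (pow_ne_zero _ (Polynomial.X_sub_C_ne_zero ζ)) hR0]
        exact Nat.le_add_left _ _
    -- Away from the boundary the bounds depend on `w` only through `s`; boundedness of the degree
    -- carries them to the whole disc.
    have hRhalf : ∀ x : ℂ, ‖x‖ ≤ 1 / 2 → ‖R.eval x‖ ≤ S * s := by
      intro x hx
      have hx1 : ‖x‖ < 1 := by linarith
      have hxm : x ∈ Metric.closedBall (0 : ℂ) (1 / 2) := by simpa using hx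
      have hxm1 : x ∈ Metric.closedBall (0 : ℂ) 1 := by simpa using hx1.le
      have h1 := hPw x hx1
      have h2 : ‖(1 - (starRingEnd ℂ) w * φ x)⁻¹‖ ≤ Kφ := by
        refine le_trans ?_ ((le_abs_self _).trans (hKφ x hxm))
        rw [norm_inv]
        refine inv_anti₀ (sub_pos.2 (hmaps' hx1)) ?_
        have := norm_sub_norm_le (1 : ℂ) ((starRingEnd ℂ) w * φ x)
        rw [norm_one, norm_mul, RCLike.norm_conj] at this
        nlinarith [norm_nonneg w, norm_nonneg (φ x)]
      have h3 : ‖β.eval x * f x‖ ≤ Kβ * (KF * Kφ) := by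
        rw [hfF, norm_mul, norm_mul]
        exact mul_le_mul (hKβ x hxm1) (mul_le_mul (hKF x hxm) h2 (norm_nonneg _) hKF0)
          (by positivity) hKβ0
      have h4 : 1 / 2 ≤ Real.sqrt (1 - ‖x‖ ^ 2) :=
        Real.le_sqrt_of_sq_le (by nlinarith [norm_nonneg x])
      have h5 : ‖α.eval x‖ * (deBrangesNorm b f / Real.sqrt (1 - ‖x‖ ^ 2)) ≤
          Kα * (|C₀| * s / (1 / 2)) := by
        have hf0 : 0 ≤ deBrangesNorm b f := Real.sqrt_nonneg _
        have := hKα x hxm1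
        gcongr
      have h6 := norm_sub_norm_le (Pw.eval x) (β.eval x * f x)
      rw [norm_sub_rev] at h6
      have h7 : ‖Pw.eval x‖ ≤ (Kβ * (KF * Kφ) + Kα * (2 * |C₀|)) * s := by
        have : Kβ * (KF * Kφ) * 1 ≤ Kβ * (KF * Kφ) * s := by gcongr
        linarith
      have h8 : 1 / 2 ≤ ‖x - ζ‖ := by
        have := norm_sub_norm_le ζ x
        rw [norm_sub_rev, hζ] at this
        linarith
      rw [hR, Polynomial.eval_mul, Polynomial.eval_pow, Polynomial.eval_sub, Polynomial.eval_X,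
        Polynomial.eval_C, norm_mul, norm_pow] at h7
      have h9 : (1 / 2 : ℝ) ^ m * ‖R.eval x‖ ≤ (Kβ * (KF * Kφ) + Kα * (2 * |C₀|)) * s :=
        le_trans (by gcongr) h7
      have h10 := mul_le_mul_of_nonneg_left h9 (show (0 : ℝ) ≤ 2 ^ m by positivity)
      rw [← mul_assoc, ← mul_pow] at h10
      norm_num at h10
      rw [hS]
      linarith
    have hRr := hC₁ R (S * s) hRdeg hRhalf (r * ζ) (by rw [hr2]; exact hr1.le)
    have h1 := hr4 f Pw hPw
    have h2 : ‖Pw.eval (r * ζ)‖ ≤ C₁ * (S * s) * t r := by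
      rw [hR, Polynomial.eval_mul, Polynomial.eval_pow, Polynomial.eval_sub, Polynomial.eval_X,
        Polynomial.eval_C, norm_mul, norm_pow, hr3, mul_comm]
      exact mul_le_mul hRr (htpow r hr0 hr1) (pow_nonneg (sub_pos.2 hr1).le _) (by positivity)
    have h3 : K * deBrangesNorm b f * t r ≤ K * (|C₀| * s) * t r := by
      have := ht0 r hr1
      gcongr
    have h4 := norm_sub_norm_le (β.eval (r * ζ) * f (r * ζ)) (Pw.eval (r * ζ))
    rw [hfF, norm_mul, norm_mul] at h4
    rw [hfF] at h1
    calc _ ≤ C₁ * (S * s) * t r + K * (|C₀| * s) * t r := by linarith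
      _ = _ := by ring
  have hβlim : Tendsto (fun r : ℝ => ‖β.eval (r * ζ)‖) (𝓝[<] 1) (𝓝 ‖β.eval ζ‖) :=
    ((β.continuous.tendsto ζ).comp (tendsto_ofReal_mul_nhdsLT ζ)).norm
  have hβ0 := norm_pos_iff.2 hβ
  set C₂ := C₁ * S + K * |C₀| with hC₂
  have hC₂0 : 0 ≤ C₂ := by positivity
  -- The outer `2` compensates `(1 - |w|) / (1 - |w|²) ≥ 1/2`; the inner one comes from `|β (r ζ)| >
  -- |β ζ| / 2`.
  refine ⟨2 * (C₂ / (‖β.eval ζ‖ / 2 * κ)) ^ 2, ?_⟩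
  filter_upwards [hrad, main, hβlim.eventually (lt_mem_nhds (half_lt_self hβ0)),
    hlim.eventually haη] with r ⟨hr0, hr1, hr2, _⟩ hmain hβr har
  have hw := hmaps' (x := r * ζ) (by rw [hr2]; exact hr1)
  have h1 := hmain _ hw
  set w := φ (r * ζ) with hwdef
  have hE : 0 < 1 - ‖w‖ ^ 2 := by nlinarith [norm_nonneg w]
  have hk : ‖(1 - (starRingEnd ℂ) w * w)⁻¹‖ = (1 - ‖w‖ ^ 2)⁻¹ := by
    rw [← Complex.normSq_eq_conj_mul_self, Complex.normSq_eq_norm_sq, norm_inv,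
      show (1 - ((‖w‖ ^ 2 : ℝ) : ℂ)) = ((1 - ‖w‖ ^ 2 : ℝ) : ℂ) by push_cast; ring,
      Complex.norm_real, Real.norm_of_nonneg hE.le]
  rw [hk] at h1
  set s := Real.sqrt (1 - ‖w‖ ^ 2)⁻¹ with hs
  have hs0 : 0 < s := Real.sqrt_pos.2 (inv_pos.2 hE)
  have hss : s * s = (1 - ‖w‖ ^ 2)⁻¹ := Real.mul_self_sqrt (inv_pos.2 hE).le
  rw [← hss] at h1
  have h2 : ‖β.eval (r * ζ)‖ * (‖F (r * ζ)‖ * s) ≤ C₂ * t r := by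
    refine le_of_mul_le_mul_right ?_ hs0
    linarith
  have hFge : ‖u (r * ζ)‖ * (κ * (1 - ‖w‖) ^ M) ≤ ‖F (r * ζ)‖ := by
    simp only [hFdef, norm_mul]
    refine mul_le_mul_of_nonneg_left (le_trans ?_ har) (norm_nonneg _)
    have h3 := norm_sub_norm_le η w
    rw [hη, norm_sub_rev] at h3
    have := sub_pos.2 hw
    gcongr
  have hd : 0 < 1 - ‖w‖ := sub_pos.2 hw
  have h4 : ‖β.eval ζ‖ / 2 * κ * (‖u (r * ζ)‖ * (1 - ‖w‖) ^ M * s) ≤ C₂ * t r := by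
    refine le_trans ?_ h2
    calc ‖β.eval ζ‖ / 2 * κ * (‖u (r * ζ)‖ * (1 - ‖w‖) ^ M * s)
        = ‖β.eval ζ‖ / 2 * (‖u (r * ζ)‖ * (κ * (1 - ‖w‖) ^ M) * s) := by ring
      _ ≤ _ := by gcongr
  have h5 : ‖u (r * ζ)‖ * (1 - ‖w‖) ^ M * s ≤ C₂ / (‖β.eval ζ‖ / 2 * κ) * t r := by
    rw [div_mul_eq_mul_div, le_div_iff₀ (by positivity)]
    linarith
  have h6 := pow_le_pow_left₀ (by positivity) h5 2
  have hr' : 0 < 1 - r := sub_pos.2 hr1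
  have ht2 : t r ^ 2 = (1 - r) ^ (2 * m - 1) := by
    simp only [ht]
    rw [div_pow, Real.sq_sqrt hr'.le, ← pow_mul, div_eq_iff hr'.ne', ← pow_succ]
    congr 1
    omega
  rw [mul_pow, mul_pow _ (t r), ht2, mul_pow, sq s, hss, ← pow_mul] at h6
  have h7 : (1 - ‖w‖) ^ (M * 2) = (1 - ‖w‖) ^ (2 * M - 1) * (1 - ‖w‖) := by
    rw [← pow_succ]
    congr 1
    omega
  have h8 : 1 / 2 ≤ (1 - ‖w‖) * (1 - ‖w‖ ^ 2)⁻¹ := by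
    rw [← div_eq_mul_inv, le_div_iff₀ hE]
    nlinarith [norm_nonneg w]
  have h9 : ‖u (r * ζ)‖ ^ 2 * (1 - ‖w‖) ^ (2 * M - 1) * (1 / 2) ≤
      ‖u (r * ζ)‖ ^ 2 * (1 - ‖w‖) ^ (M * 2) * (1 - ‖w‖ ^ 2)⁻¹ := by
    rw [h7]
    calc _ ≤ ‖u (r * ζ)‖ ^ 2 * (1 - ‖w‖) ^ (2 * M - 1) * ((1 - ‖w‖) * (1 - ‖w‖ ^ 2)⁻¹) := by
          gcongr
      _ = _ := by ring
  linarith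

/-! ### Rational functions on the closed disc and boundary limits -/

theorem ratFun_eq_div (q : RatFunc ℂ) (z : ℂ) :
    ratFun q z = q.num.eval z / q.denom.eval z := by
  simp [ratFun, RatFunc.eval, Polynomial.eval₂_id]

theorem differentiableAt_ratFun {q : RatFunc ℂ} {z : ℂ} (hz : q.denom.eval z ≠ 0) :
    DifferentiableAt ℂ (ratFun q) z := by
  rw [funext (ratFun_eq_div q)]
  exact q.num.differentiable.differentiableAt.div q.denom.differentiable.differentiableAt hz

open Filter Topology in
/-- A rational function that is bounded on the disc has no poles on its closure. -/
theorem denom_eval_ne_zero_of_norm_le {b : RatFunc ℂ}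
    (hpoles : ∀ z ∈ Metric.ball (0 : ℂ) 1, b.denom.eval z ≠ 0)
    (hb1 : ∀ z : ℂ, ‖z‖ < 1 → ‖ratFun b z‖ ≤ 1) {z : ℂ} (hz : ‖z‖ ≤ 1) :
    b.denom.eval z ≠ 0 := by
  rcases hz.lt_or_eq with hz | hz
  · exact hpoles z (by simpa using hz)
  intro h0
  -- Passing `|num| ≤ |denom|` to the boundary forces a common zero, against coprimality.
  have h1 : Tendsto (fun r : ℝ => ‖b.num.eval (r * z)‖) (𝓝[<] 1) (𝓝 ‖b.num.eval z‖) :=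
    ((b.num.continuous.tendsto z).comp (tendsto_ofReal_mul_nhdsLT z)).norm
  have h2 : Tendsto (fun r : ℝ => ‖b.denom.eval (r * z)‖) (𝓝[<] 1) (𝓝 ‖b.denom.eval z‖) :=
    ((b.denom.continuous.tendsto z).comp (tendsto_ofReal_mul_nhdsLT z)).norm
  have h3 := le_of_tendsto_of_tendsto h1 h2 (by
    filter_upwards [norm_ofReal_mul_eventually hz] with r ⟨_, hr1, hr2, _⟩
    have hr : ‖(r : ℂ) * z‖ < 1 := by rw [hr2]; exact hr1
    have h4 := hb1 _ hr
    rw [ratFun_eq_div, norm_div] at h4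
    rwa [div_le_one (norm_pos_iff.2 (hpoles _ (by simpa using hr)))] at h4)
  rw [h0, norm_zero, norm_le_zero_iff] at h3
  obtain ⟨x, y, hxy⟩ := b.isCoprime_num_denom
  have h5 := congrArg (Polynomial.eval z) hxy
  simp [h0, h3] at h5

/-- If `|a|² + |b|² ≤ 1` on the unit circle, then the same holds in the disc. -/
theorem norm_sq_add_norm_sq_le_one {a b : ℂ → ℂ} (ha : DiffContOnCl ℂ a (Metric.ball 0 1))
    (hb : DiffContOnCl ℂ b (Metric.ball 0 1))
    (hab : ∀ z : ℂ, ‖z‖ = 1 → ‖a z‖ ^ 2 + ‖b z‖ ^ 2 ≤ 1) {z : ℂ} (hz : ‖z‖ < 1) :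
    ‖a z‖ ^ 2 + ‖b z‖ ^ 2 ≤ 1 := by
  set S := ‖a z‖ ^ 2 + ‖b z‖ ^ 2 with hS
  have hS0 : 0 ≤ S := by positivity
  -- Linearization at the fixed point `z`: `g z = S`, while Cauchy–Schwarz gives `|g| ≤ √S` on the
  -- circle, so `S ≤ √S`.
  set g : ℂ → ℂ := fun w => (starRingEnd ℂ) (a z) * a w + (starRingEnd ℂ) (b z) * b w with hg
  have hgd : DiffContOnCl ℂ g (Metric.ball 0 1) :=
    (ha.const_smul ((starRingEnd ℂ) (a z))).add (hb.const_smul ((starRingEnd ℂ) (b z)))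
  have h1 := Complex.norm_le_of_forall_mem_frontier_norm_le Metric.isBounded_ball hgd
    (C := Real.sqrt S) (fun w hw => by
      rw [frontier_ball (0 : ℂ) one_ne_zero, mem_sphere_zero_iff_norm] at hw
      refine Real.le_sqrt_of_sq_le ?_
      have h2 := norm_add_le ((starRingEnd ℂ) (a z) * a w) ((starRingEnd ℂ) (b z) * b w)
      rw [norm_mul, norm_mul, RCLike.norm_conj, RCLike.norm_conj] at h2
      calc ‖g w‖ ^ 2 ≤ (‖a z‖ * ‖a w‖ + ‖b z‖ * ‖b w‖) ^ 2 :=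
            pow_le_pow_left₀ (norm_nonneg _) h2 2
        _ ≤ S * (‖a w‖ ^ 2 + ‖b w‖ ^ 2) := by
            rw [hS]
            nlinarith [sq_nonneg (‖a z‖ * ‖b w‖ - ‖b z‖ * ‖a w‖)]
        _ ≤ S := mul_le_of_le_one_right hS0 (hab w hw))
    (subset_closure (show z ∈ Metric.ball (0 : ℂ) 1 by simpa using hz))
  have h2 : g z = (S : ℂ) := by
    simp only [hg, ← Complex.normSq_eq_conj_mul_self, Complex.normSq_eq_norm_sq, hS]
    push_cast
    ring
  rw [h2, Complex.norm_real, Real.norm_of_nonneg hS0] at h1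
  have h3 := Real.sq_sqrt hS0
  by_contra! h
  nlinarith [Real.sqrt_nonneg S]

open Filter Topology in
theorem exists_eventually_mul_pow_le_norm_ratFun {a : RatFunc ℂ} {η : ℂ} (ha : a.num ≠ 0)
    (hη : a.denom.eval η ≠ 0) :
    ∃ κ : ℝ, 0 < κ ∧ ∀ᶠ w in 𝓝 η, κ * ‖w - η‖ ^ a.num.rootMultiplicity η ≤ ‖ratFun a w‖ := by
  obtain ⟨Q, hQ, hQd⟩ := Polynomial.exists_eq_pow_rootMultiplicity_mul_and_not_dvd a.num ha η
  have hQη : Q.eval η ≠ 0 := fun h0 => hQd (Polynomial.dvd_iff_isRoot.2 h0)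
  have hc : ContinuousAt (fun w => ‖Q.eval w / a.denom.eval w‖) η :=
    (Q.continuous.continuousAt.div a.denom.continuous.continuousAt hη).norm
  have hpos : 0 < ‖Q.eval η / a.denom.eval η‖ := norm_pos_iff.2 (div_ne_zero hQη hη)
  refine ⟨‖Q.eval η / a.denom.eval η‖ / 2, by positivity, ?_⟩
  filter_upwards [hc.eventually (lt_mem_nhds (half_lt_self hpos))] with w hw
  have e : ‖ratFun a w‖ = ‖Q.eval w / a.denom.eval w‖ * ‖w - η‖ ^ a.num.rootMultiplicity η := by
    rw [ratFun_eq_div, ← norm_pow, ← norm_mul]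
    congr 1
    conv_lhs => rw [hQ]
    rw [Polynomial.eval_mul, Polynomial.eval_pow, Polynomial.eval_sub, Polynomial.eval_X,
      Polynomial.eval_C]
    ring
  rw [e]
  exact mul_le_mul_of_nonneg_right hw.le (by positivity)

open Filter Topology in
/-- A function which differs from a polynomial multiple by little near a boundary point has a
non-tangential limit there. -/
theorem exists_hasNontangentialLimit {f : ℂ → ℂ} {ζ : ℂ} (hζ : ‖ζ‖ = 1)
    {α β P : Polynomial ℂ} (hβ : β.eval ζ ≠ 0) {K C : ℝ} {m : ℕ} (hm : 0 < m) (hK : 0 < K)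
    (hC : 0 ≤ C) (hα : ∀ᶠ z in 𝓝 ζ, ‖α.eval z‖ ≤ K * ‖z - ζ‖ ^ m)
    (hP : ∀ z : ℂ, ‖z‖ < 1 → ‖β.eval z * f z - P.eval z‖ ≤
      ‖α.eval z‖ * (C / Real.sqrt (1 - ‖z‖ ^ 2))) :
    ∃ c : ℂ, HasNontangentialLimit f ζ c := by
  refine ⟨P.eval ζ / β.eval ζ, fun M => ?_⟩
  set l := 𝓝[{z : ℂ | ‖z‖ < 1 ∧ ‖z - ζ‖ < M * (1 - ‖z‖)}] ζ with hl
  have hle : l ≤ 𝓝 ζ := nhdsWithin_le_nhds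
  have hPl : Tendsto (fun z => P.eval z) l (𝓝 (P.eval ζ)) := (P.continuous.tendsto ζ).mono_left hle
  have hβl : Tendsto (fun z => β.eval z) l (𝓝 (β.eval ζ)) := (β.continuous.tendsto ζ).mono_left hle
  have hsmall : Tendsto (fun z => β.eval z * f z - P.eval z) l (𝓝 0) := by
    have hc : Continuous fun z : ℂ => K * M * C * Real.sqrt (1 - ‖z‖) := by fun_prop
    have h1 := (hc.tendsto ζ).mono_left hle
    rw [hζ, sub_self, Real.sqrt_zero, mul_zero] at h1
    refine squeeze_zero_norm' ?_ h1
    have hnear : ∀ᶠ z in 𝓝 ζ, ‖z - ζ‖ < 1 := by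
      have : Continuous fun z : ℂ => ‖z - ζ‖ := by fun_prop
      exact (this.tendsto ζ).eventually (gt_mem_nhds (by simp))
    filter_upwards [hle hα, hle hnear, self_mem_nhdsWithin] with z h2 h3 ⟨hz, hzM⟩
    have ht : 0 < 1 - ‖z‖ := sub_pos.2 hz
    have hs := Real.sqrt_pos.2 ht
    have h4 : Real.sqrt (1 - ‖z‖) ≤ Real.sqrt (1 - ‖z‖ ^ 2) :=
      Real.sqrt_le_sqrt (by nlinarith [norm_nonneg z])
    -- One factor suffices: in a Stolz region it is `O(1 - |z|)`, which beats the square root.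
    have h5 : ‖z - ζ‖ ^ m ≤ ‖z - ζ‖ := pow_le_of_le_one (norm_nonneg _) h3.le hm.ne'
    calc _ ≤ _ := hP z hz
      _ ≤ K * (M * (1 - ‖z‖)) * (C / Real.sqrt (1 - ‖z‖)) := by
        have h6 : ‖α.eval z‖ ≤ K * (M * (1 - ‖z‖)) :=
          h2.trans (mul_le_mul_of_nonneg_left (h5.trans hzM.le) hK.le)
        refine mul_le_mul h6 ?_ (by positivity) ((norm_nonneg _).trans h6)
        gcongr
      _ = K * M * C * ((1 - ‖z‖) / Real.sqrt (1 - ‖z‖)) := by ring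
      _ = _ := by rw [Real.div_sqrt]
  have h2 := (hsmall.add hPl).div hβl hβ
  rw [zero_add] at h2
  refine h2.congr' ?_
  filter_upwards [hβl.eventually_ne hβ] with z hz
  simp only [Pi.div_apply]
  field_simp
  ring

/-! ### The theorem -/

open Filter Topology in
/-- Here `b` is a rational function, not inner, in the closed unit ball of `H^∞` with `‖b‖_∞ = 1`,
and `ζ 1, …, ζ n` are the zeros on the unit circle of its Pythagorean mate `a`, with multiplicities
`m 1, …, m n` (all at least `1`, so that the exponents `2 m - 1` are not truncated). -/
theorem corollary6p3
    (b a : RatFunc ℂ)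
    (hb_poles : ∀ z ∈ Metric.ball (0 : ℂ) 1, b.denom.eval z ≠ 0)
    (hb_norm : IsLUB ((fun z => ‖ratFun b z‖) '' Metric.ball (0 : ℂ) 1) 1)
    (hb_not_inner : ¬ ∀ z ∈ Metric.sphere (0 : ℂ) 1, ‖ratFun b z‖ = 1)
    (ha : IsPythagoreanMate b a)
    (n : ℕ) (ζ : Fin n → ℂ) (m : Fin n → ℕ)
    (hζ_inj : Function.Injective ζ)
    (hζ : Set.range ζ = {z ∈ Metric.sphere (0 : ℂ) 1 | ratFun a z = 0})
    (hm : ∀ i, m i = a.num.rootMultiplicity (ζ i))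
    (u φ : ℂ → ℂ)
    (hu : DifferentiableOn ℂ u (Metric.ball 0 1))
    (hφ : DifferentiableOn ℂ φ (Metric.ball 0 1))
    (hφ_maps : Set.MapsTo φ (Metric.ball 0 1) (Metric.ball 0 1))
    (hW : IsBoundedWeightedComposition (ratFun b) u φ)
    (k l : Fin n)
    (hkl : HasNontangentialLimit φ (ζ k) (ζ l)) :
    Filter.liminf
        (fun z : ℂ => ENNReal.ofReal
          (‖u z‖ ^ 2 * ((1 - ‖φ z‖) ^ (2 * m l - 1) / (1 - ‖z‖) ^ (2 * m k - 1))))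
        (nhdsWithin (ζ k) (Metric.ball 0 1)) < ⊤ ∧
    ∃ c : ℂ, HasNontangentialLimit u (ζ k) c ∧
      (c ≠ 0 → m k ≤ m l ∧ (m k = m l → HasAngularDerivative φ (ζ k))) := by
  have hmaps' : ∀ {x : ℂ}, ‖x‖ < 1 → ‖φ x‖ < 1 := fun {x} hx => by
    simpa using hφ_maps (show x ∈ Metric.ball (0 : ℂ) 1 by simpa using hx)
  have hb1 : ∀ z : ℂ, ‖z‖ < 1 → ‖ratFun b z‖ ≤ 1 := fun z hz =>
    hb_norm.1 ⟨z, by simpa using hz, rfl⟩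
  have hbden : ∀ z : ℂ, ‖z‖ ≤ 1 → b.denom.eval z ≠ 0 := fun z hz =>
    denom_eval_ne_zero_of_norm_le hb_poles hb1 hz
  have haden : ∀ z : ℂ, ‖z‖ ≤ 1 → a.denom.eval z ≠ 0 := fun z hz =>
    ha.denom_ne_zero z (by simpa using hz)
  have diffCont : ∀ q : RatFunc ℂ, (∀ z : ℂ, ‖z‖ ≤ 1 → q.denom.eval z ≠ 0) →
      DiffContOnCl ℂ (ratFun q) (Metric.ball 0 1) := fun q hq =>
    DifferentiableOn.diffContOnCl fun z hz => by
      rw [closure_ball (0 : ℂ) one_ne_zero, mem_closedBall_zero_iff] at hz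
      exact (differentiableAt_ratFun (hq z hz)).differentiableWithinAt
  have had := diffCont a haden
  have hbd := diffCont b hbden
  have hcirc : ∀ z : ℂ, ‖z‖ = 1 → ‖ratFun a z‖ ^ 2 + ‖ratFun b z‖ ^ 2 = 1 := fun z hz =>
    ha.normSq_add_normSq z (by simpa using hz)
  have hab : ∀ z : ℂ, ‖z‖ < 1 → ‖ratFun a z‖ ^ 2 + ‖ratFun b z‖ ^ 2 ≤ 1 := fun z hz =>
    norm_sq_add_norm_sq_le_one had hbd (fun z hz => (hcirc z hz).le) hz
  have ha0 : ratFun a 0 ≠ 0 := by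
    obtain ⟨x, hx, hx0⟩ := ha.pos_at_zero
    rw [hx0]
    exact_mod_cast hx.ne'
  have hanum : a.num ≠ 0 := fun h => ha0 (by rw [ratFun_eq_div, h]; simp)
  have hζn : ∀ i, ‖ζ i‖ = 1 ∧ ratFun a (ζ i) = 0 := fun i => by
    have : ζ i ∈ {z ∈ Metric.sphere (0 : ℂ) 1 | ratFun a z = 0} := hζ ▸ Set.mem_range_self i
    exact ⟨by simpa using this.1, this.2⟩
  have hmpos : ∀ i, 0 < m i := fun i => by
    rw [hm, Polynomial.rootMultiplicity_pos hanum]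
    have h1 := (hζn i).2
    rw [ratFun_eq_div] at h1
    exact (div_eq_zero_iff.1 h1).resolve_right (haden _ (hζn i).1.le)
  set A := a.num * b.denom with hA
  set B := b.num * a.denom with hB
  set N := max A.natDegree B.natDegree with hN
  have hA0 : A ≠ 0 := mul_ne_zero hanum b.denom_ne_zero
  have hBζ : B.eval (ζ k) ≠ 0 := by
    have h1 := hcirc _ (hζn k).1
    rw [(hζn k).2, norm_zero] at h1
    rw [hB, Polynomial.eval_mul]
    refine mul_ne_zero (fun h0 => ?_) (haden _ (hζn k).1.le)
    rw [ratFun_eq_div, h0] at h1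
    simp at h1
  have hexp : ∀ f : ℂ → ℂ, MemDeBranges (ratFun b) f → ∃ P : Polynomial ℂ, P.natDegree ≤ N ∧
      ∀ z : ℂ, ‖z‖ < 1 → ‖(conjReflect N B).eval z * f z - P.eval z‖ ≤
        ‖(conjReflect N A).eval z‖ *
          (deBrangesNorm (ratFun b) f / Real.sqrt (1 - ‖z‖ ^ 2)) := fun f hf => by
    refine exists_polynomial_norm_sub_le (D := a.denom * b.denom) hbd.differentiableOn hb1 ?_ ?_ hA0
      (le_max_left _ _) (le_max_right _ _) hf
    · intro z hz
      have := hbden z hz.le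
      rw [ratFun_eq_div, hB, Polynomial.eval_mul, Polynomial.eval_mul]
      field_simp
    · intro z hz
      have h1 := hbden z hz.le
      have h2 := haden z hz.le
      have h3 := hcirc z hz
      rw [ratFun_eq_div, ratFun_eq_div, norm_div, norm_div] at h3
      simp only [hA, hB, Polynomial.eval_mul, norm_mul]
      have h1' := norm_pos_iff.2 h1
      have h2' := norm_pos_iff.2 h2
      field_simp at h3
      linarith
  obtain ⟨K, hK, hα⟩ := eventually_norm_conjReflect_le (hζn k).1 (A := A) (m := m k)
    (le_max_left A.natDegree B.natDegree)
    (by rw [hm]; exact (Polynomial.pow_rootMultiplicity_dvd _ _).mul_right _)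
  have hβ := eval_conjReflect_ne_zero (hζn k).1 (le_max_right A.natDegree B.natDegree) hBζ
  obtain ⟨κ, hκ, haη⟩ := exists_eventually_mul_pow_le_norm_ratFun hanum (haden _ (hζn l).1.le)
  rw [← hm l] at haη
  obtain ⟨C, hC⟩ := exists_eventually_norm_sq_mul_le had.differentiableOn hbd.differentiableOn hab
    hφ hφ_maps hW (hζn k).1 (hζn l).1 (hkl.tendsto_radial (hζn k).1) (hmpos k) (hmpos l) hβ hK hα
    hexp hκ haη
  have hrad := norm_ofReal_mul_eventually (hζn k).1
  refine ⟨lt_of_le_of_lt (liminf_le_of_frequently_le' (x := ENNReal.ofReal C) ?_)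
    ENNReal.ofReal_lt_top, ?_⟩
  · have ht : Tendsto (fun r : ℝ => (r : ℂ) * ζ k) (𝓝[<] 1) (𝓝[Metric.ball 0 1] (ζ k)) :=
      tendsto_nhdsWithin_iff.2 ⟨tendsto_ofReal_mul_nhdsLT _, by
        filter_upwards [hrad] with r ⟨_, hr1, hr2, _⟩
        rw [mem_ball_zero_iff, hr2]
        exact hr1⟩
    refine ht.frequently (Eventually.frequently ?_)
    filter_upwards [hrad, hC] with r ⟨_, hr1, hr2, _⟩ hr
    refine ENNReal.ofReal_le_ofReal ?_
    rw [hr2, ← mul_div_assoc, div_le_iff₀ (pow_pos (sub_pos.2 hr1) _)]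
    exact hr
  -- `u` is the image of the constant `1`, so the expansion gives its boundary value.
  have hu1 := (hW.choose_spec _
    (memDeBranges_one had.differentiableOn hbd.differentiableOn hab ha0)).1
  simp only [mul_one] at hu1
  obtain ⟨P, _, hP⟩ := hexp u hu1
  obtain ⟨c, hc⟩ := exists_hasNontangentialLimit (hζn k).1 hβ (hmpos k) hK (Real.sqrt_nonneg _) hα hP
  refine ⟨c, hc, fun hc0 => ?_⟩
  have hc0' := norm_pos_iff.2 hc0
  set C' := C / (‖c‖ / 2) ^ 2 with hC'
  have hCφ : ∀ᶠ r : ℝ in 𝓝[<] 1,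
      (1 - ‖φ (r * ζ k)‖) ^ (2 * m l - 1) ≤ C' * (1 - r) ^ (2 * m k - 1) := by
    filter_upwards [hC, hrad, (hc.tendsto_radial (hζn k).1).norm.eventually
      (lt_mem_nhds (half_lt_self hc0'))] with r hr ⟨_, hr1, hr2, _⟩ hur
    rw [hC', div_mul_eq_mul_div, le_div_iff₀ (by positivity), mul_comm]
    refine le_trans ?_ hr
    have := sub_pos.2 (hmaps' (x := r * ζ k) (by rw [hr2]; exact hr1))
    gcongr
  constructor
  · by_contra! hlt
    obtain ⟨c₀, hc₀, hc₀'⟩ := one_sub_norm_ge_of_mapsTo_ball hφ hφ_maps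
    obtain ⟨j, hj⟩ := Nat.exists_eq_add_of_lt hlt
    have hle : ∀ᶠ r : ℝ in 𝓝[<] 1, c₀ ^ (2 * m l - 1) ≤ C' * (1 - r) ^ (2 * j + 2) := by
      filter_upwards [hCφ, hrad] with r hr ⟨_, hr1, hr2, _⟩
      have h1 := hc₀' (r * ζ k) (by rw [hr2]; exact hr1)
      rw [hr2] at h1
      have h2 : 0 < 1 - r := sub_pos.2 hr1
      have h3 := (pow_le_pow_left₀ (by positivity) h1 (2 * m l - 1)).trans hr
      -- Here `m k = m l + j + 1`; positivity of `m l` keeps the subtraction exact. The surplus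
      -- power `(1 - r)^(2j + 2)` tends to `0`, contradicting the positive lower bound.
      have h4 : 2 * m k - 1 = (2 * j + 2) + (2 * m l - 1) := by
        have := hmpos l
        omega
      rw [h4, pow_add, mul_pow, ← mul_assoc] at h3
      exact le_of_mul_le_mul_right h3 (pow_pos h2 _)
    have hcont : Continuous fun r : ℝ => C' * (1 - r) ^ (2 * j + 2) := by fun_prop
    have h1 := (hcont.tendsto 1).mono_left (nhdsWithin_le_nhds (s := Set.Iio 1))
    have h2 := ge_of_tendsto h1 hle
    simp only [sub_self, ne_eq, Nat.add_eq_zero_iff, OfNat.ofNat_ne_zero, and_false,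
      not_false_eq_true, zero_pow, mul_zero] at h2
    exact absurd h2 (not_le.2 (pow_pos hc₀ _))
  · intro hmm
    refine hasAngularDerivative_of_one_sub_norm_le hφ hφ_maps (hζn k).1 (hζn l).1 hkl
      -- The maximum with `1` ensures `C' ≤ A ^ (2 * m l - 1)`, so a root can be extracted.
      (A := max C' 1) ?_
    filter_upwards [hCφ, hrad] with r hr ⟨_, hr1, hr2, _⟩
    have h2 : 0 < 1 - r := sub_pos.2 hr1
    have hp : 2 * m l - 1 ≠ 0 := by
      have := hmpos l
      omega
    have hmax : 1 ≤ max C' 1 := le_max_right _ _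
    rw [hmm] at hr
    refine le_of_pow_le_pow_left₀ hp (by positivity) (hr.trans ?_)
    rw [mul_pow]
    refine mul_le_mul_of_nonneg_right ?_ (by positivity)
    exact (le_max_left _ _).trans (le_self_pow₀ hmax hp)
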